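/- Let $F_\infty$ be the free group on countably infinitely many generators, let $C^*(F_\infty)$ be its full group $C^*$-algebra, and let $\ell^2=\ell^2(\mathbb N)$ over $\mathbb C$. A \emph{bounded representation} of a $C^*$-algebra on a Hilbert space $K$ is a norm-bounded algebra homomorphism into $\mathcal B(K)$ (not assumed to preserve adjoints or units). Let $\phi : C^*(F_\infty)\to\mathcal B(\ell^2)$ be a bounded representation. Let $\mathcal H$ be a complex Hilbert space and let $\mathcal B(\ell^2)$ act on $\mathcal H$ as a von Neumann algebra: $\rho$ is a $*$-isomorphism of $\mathcal B(\ell^2)$ onto a von Neumann algebra $\mathcal M\subseteq\mathcal B(\mathcal H)$. Suppose that some $\xi\in\mathcal H$ is cyclic ($\overline{\mathcal M\xi}=\mathcal H$) and separating ($x\in\mathcal M$, $x\xi=0$ imply $x=0$) for $\mathcal M$. Let $\mathcal B\subseteq\mathcal M'$ be a (not necessarily unital) $C^*$-subalgebra that is dense in the commutant $\mathcal M'$ for the weak operator topology. Let $\otimes_{\max}$ denote the maximal $C^*$-tensor product, the completion of the algebraic tensor product for the norm $\|\sum_j a_j\otimes b_j\|_{\max}=\sup\|\sum_j\sigma(a_j)\tau(b_j)\|$,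 where the supremum is over all pairs $(\sigma,\tau)$ of $*$-representations of the two algebras on a common Hilbert space with commuting ranges. Then the following are equivalent: (1) $\phi$ is similar to a $*$-representation of $C^*(F_\infty)$ into $\mathcal B(\ell^2)$, i.e. there is an invertible $S\in\mathcal B(\ell^2)$ such that $S\phi(\cdot)S^{-1}$ is a $*$-homomorphism; (2) the formula $\Phi\bigl(\sum_{i=1}^n a_i\otimes b_i\bigr)=\sum_{i=1}^n\rho(\phi(a_i))\,b_i$ (with $a_i\in C^*(F_\infty)$, $b_i\in\mathcal B$) defines a bounded representation $\Phi : C^*(F_\infty)\otimes_{\max}\mathcal B\to\mathcal B(\mathcal H)$. -/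

import Mathlib

open scoped ENNReal

noncomputable section

universe u v

/-! ### The full group C⋆-algebra -/

/-- A unitary representation of a group on a (nonzero) complex Hilbert space. -/
structure UnitaryRep (G : Type u) [Group G] where
  /-- The Hilbert space of the representation. -/
  space : Type u
  [normedAddCommGroup : NormedAddCommGroup space]
  [innerProductSpace : InnerProductSpace ℂ space]
  [completeSpace : CompleteSpace space]
  [nontrivial : Nontrivial space]
  /-- The homomorphism into the unitary group. -/
  rep : G →* unitary (space →L[ℂ] space)

attribute [instance] UnitaryRep.normedAddCommGroup UnitaryRep.innerProductSpace
  UnitaryRep.completeSpace UnitaryRep.nontrivial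

/-- The ℓ^∞-product of the algebras `B(K)` over all unitary representations of `G` on a Hilbert
space `K`, i.e. the block diagonal operators on the space of the universal representation. -/
abbrev UniversalGroupProduct (G : Type u) [Group G] : Type (u + 1) :=
  lp (fun π : UnitaryRep G => π.space →L[ℂ] π.space) ∞

instance (G : Type u) [Group G] : CStarAlgebra (UniversalGroupProduct G) where

/-- The universal unitary representation: `g` is sent to the family `(π(g))_π`. -/
def universalUnitary {G : Type u} [Group G] (g : G) : UniversalGroupProduct G :=
  ⟨fun π => (π.rep g : π.space →L[ℂ] π.space),
    memℓp_infty ⟨1, by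
      rintro _ ⟨π, rfl⟩
      exact CStarRing.norm_of_mem_unitary (π.rep g).2 |>.le⟩⟩

/-- The full group C⋆-algebra `C*(G)` of a discrete group `G`: the norm closed ⋆-algebra generated
by the image of `G` under the universal unitary representation. Equivalently, it is the completion
of `ℂ[G]` for the norm `‖x‖ = sup_π ‖π(x)‖` over all unitary representations of `G`. -/
def fullGroupCStar (G : Type u) [Group G] : StarSubalgebra ℂ (UniversalGroupProduct G) :=
  (StarAlgebra.adjoin ℂ (Set.range (universalUnitary (G := G)))).topologicalClosure

instance (G : Type u) [Group G] : IsClosed (fullGroupCStar G : Set (UniversalGroupProduct G)) :=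
  StarSubalgebra.isClosed_topologicalClosure _

/-- `C*(F_∞)`, the full C⋆-algebra of the free group on countably infinitely many generators. -/
def CStarFInfty : Type 1 := fullGroupCStar (FreeGroup ℕ)

instance : CStarAlgebra CStarFInfty :=
  StarSubalgebra.cstarAlgebra (fullGroupCStar (FreeGroup ℕ))

/-! ### The maximal tensor product -/

/-- A pair of commuting ⋆-representations of `A` and `B` on a common Hilbert space. -/
structure CommutingPair (A : Type u) (B : Type v) [NonUnitalCStarAlgebra A]
    [NonUnitalCStarAlgebra B] where
  /-- The common Hilbert space. -/
  space : Type (max u v)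
  [normedAddCommGroup : NormedAddCommGroup space]
  [innerProductSpace : InnerProductSpace ℂ space]
  [completeSpace : CompleteSpace space]
  /-- The representation of `A`. -/
  left : A →⋆ₙₐ[ℂ] (space →L[ℂ] space)
  /-- The representation of `B`. -/
  right : B →⋆ₙₐ[ℂ] (space →L[ℂ] space)
  commute : ∀ a b, Commute (left a) (right b)

attribute [instance] CommutingPair.normedAddCommGroup CommutingPair.innerProductSpace
  CommutingPair.completeSpace

section MaxTensor

variable (A : Type u) (B : Type v) [NonUnitalCStarAlgebra A] [NonUnitalCStarAlgebra B]

/-- The ℓ^∞-product of the algebras `B(K)` over all commuting pairs of ⋆-representations of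
`A` and `B` on a Hilbert space `K`. -/
abbrev UniversalPairProduct : Type (max (u + 1) (v + 1)) :=
  lp (fun p : CommutingPair A B => p.space →L[ℂ] p.space) ∞

variable {A B} in
/-- The elementary tensor `a ⊗ b`, realized as the family `(φ(a)ψ(b))` over all commuting pairs
`(φ, ψ)` of ⋆-representations. -/
def universalTmul (a : A) (b : B) : UniversalPairProduct A B :=
  ⟨fun p => p.left a * p.right b,
    memℓp_infty ⟨‖a‖ * ‖b‖, by
      rintro _ ⟨p, rfl⟩
      exact (norm_mul_le _ _).trans (mul_le_mul (NonUnitalStarAlgHom.norm_apply_le p.left a)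
        (NonUnitalStarAlgHom.norm_apply_le p.right b) (norm_nonneg _) (norm_nonneg _))⟩⟩

/-- The maximal C⋆-tensor product `A ⊗_max B`: the closed ⋆-algebra generated by the elementary
tensors. The norm of `∑ aⱼ ⊗ bⱼ` is the supremum of `‖∑ φ(aⱼ) ψ(bⱼ)‖` over all commuting pairs
`(φ, ψ)` of ⋆-representations of `A` and `B`. -/
def maxTensorSubalgebra : NonUnitalStarSubalgebra ℂ (UniversalPairProduct A B) :=
  (NonUnitalStarAlgebra.adjoin ℂ
    (Set.range fun x : A × B => universalTmul x.1 x.2)).topologicalClosure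

instance : IsClosed (maxTensorSubalgebra A B : Set (UniversalPairProduct A B)) :=
  NonUnitalStarSubalgebra.isClosed_topologicalClosure _

/-- The C⋆-algebra `A ⊗_max B`. -/
def MaxTensor : Type (max (u + 1) (v + 1)) := maxTensorSubalgebra A B

instance : NonUnitalCStarAlgebra (MaxTensor A B) :=
  NonUnitalStarSubalgebra.nonUnitalCStarAlgebra (maxTensorSubalgebra A B)

variable {A B} in
/-- The elementary tensor `a ⊗ b` as an element of `A ⊗_max B`. -/
def maxTmul (a : A) (b : B) : MaxTensor A B :=
  ⟨universalTmul a b, NonUnitalStarSubalgebra.le_topologicalClosure _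
    (NonUnitalStarAlgebra.subset_adjoin ℂ _ ⟨(a, b), rfl⟩)⟩

end MaxTensor

/-! ### Bounded representations, similarity, vectors, weak density -/

/-- The Hilbert space `ℓ²(ℕ)` over `ℂ`. -/
abbrev EllTwo : Type := lp (fun _ : ℕ => ℂ) 2

section Operators

variable {A : Type u} [NonUnitalCStarAlgebra A]
variable {H : Type v} [NormedAddCommGroup H] [InnerProductSpace ℂ H] [CompleteSpace H]

/-- Boundedness of a representation (an algebra homomorphism into `B(H)`, not assumed to preserve
the involution, nor the unit). -/
def IsBoundedRep (φ : A →ₙₐ[ℂ] (H →L[ℂ] H)) : Prop :=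
  ∃ C : ℝ, ∀ a, ‖φ a‖ ≤ C * ‖a‖

/-- `φ` is similar to a ⋆-representation: `S φ(·) S⁻¹` is a ⋆-representation for some invertible
operator `S`. -/
def IsSimilarToStarRep (φ : A →ₙₐ[ℂ] (H →L[ℂ] H)) : Prop :=
  ∃ (S : (H →L[ℂ] H)ˣ) (π : A →⋆ₙₐ[ℂ] (H →L[ℂ] H)),
    ∀ a, π a = (S : H →L[ℂ] H) * φ a * ((S⁻¹ : (H →L[ℂ] H)ˣ) : H →L[ℂ] H)

/-- `ξ` is cyclic for `M`: the vectors `x ξ` with `x ∈ M` are dense. -/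
def IsCyclicVector (M : Set (H →L[ℂ] H)) (ξ : H) : Prop :=
  Dense ((fun x : H →L[ℂ] H => x ξ) '' M)

/-- `ξ` is separating for `M`: the only `x ∈ M` with `x ξ = 0` is `0`. -/
def IsSeparatingVector (M : Set (H →L[ℂ] H)) (ξ : H) : Prop :=
  ∀ x ∈ M, x ξ = 0 → x = 0

/-- `B` is a subset of `N` which is dense in `N` for the weak operator topology. -/
def IsWeaklyDenseIn (B N : Set (H →L[ℂ] H)) : Prop :=
  B ⊆ N ∧ ∀ x ∈ N, (ContinuousLinearMapWOT.ofCLM x : H →WOT[ℂ] H) ∈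
    closure ((fun y : H →L[ℂ] H => (ContinuousLinearMapWOT.ofCLM y : H →WOT[ℂ] H)) '' B)

end Operators

end

/-!
A separating vector `ξ` for `M ≅ B(K)`, with `K` infinite-dimensional, makes `M'` large: `B ξ` is
dense in `H`, and `M'` contains isometries with orthogonal ranges. As `B` is dense in `M'`, every
finite column of vectors of `H` is normed by the contractive rows over `B`, so the bound
`‖Φ x ξ‖² ≤ C² ⟪b ξ, ξ⟫` for `x* x ≤ 1 ⊗ b` improves to sums `∑ xₖ* xₖ ≤ 1 ⊗ b`. This is what an
extension argument needs to provide a positive functional `f` with `‖Φ x ξ‖² ≤ f (x* x)` and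
`f (1 ⊗ b* b) ≤ C² ‖b ξ‖²`. If `S` is the resulting intertwiner from the GNS representation of `f`
to `Φ`, then `q = S S*` is bounded below and `Φ x q` is ⋆-preserving in `x`. In particular `q`
commutes with `B`, hence lies in `M'' = ρ(B(K))`, and conjugating `φ` by `√(ρ⁻¹ q)` yields a
⋆-representation. Conversely, a similarity `S` that makes `φ` a ⋆-representation makes `Φ` one
through `ρ S`.
-/

noncomputable section

open scoped CStarAlgebra

/-! ### Isometries in the commutant of `B(K)` -/

section BasisIsometry

variable {𝕜 E F ι : Type*} [RCLike 𝕜] [NormedAddCommGroup E] [InnerProductSpace 𝕜 E]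
  [NormedAddCommGroup F]

lemma hilbertBasis_clm_ext [NormedSpace 𝕜 F] (b : HilbertBasis ι 𝕜 E) {S T : E →L[𝕜] F}
    (h : ∀ i, S (b i) = T (b i)) : S = T :=
  ContinuousLinearMap.ext_on (Submodule.dense_iff_topologicalClosure_eq_top.2 b.dense_span)
    (by rintro _ ⟨i, rfl⟩; exact h i)

variable [InnerProductSpace 𝕜 F]

lemma hilbertBasis_eq_of_forall_inner (b : HilbertBasis ι 𝕜 E) {x y : E}
    (h : ∀ i, inner 𝕜 (b i) x = inner 𝕜 (b i) y) : x = y := by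
  refine b.repr.injective (lp.ext (funext fun i => ?_))
  simpa only [b.repr_apply_apply] using h i

variable [CompleteSpace F]

/-- The isometry sending the vectors of a Hilbert basis to those of an orthonormal family. -/
def orthonormalIsometry (b : HilbertBasis ι 𝕜 E) {u : ι → F} (hu : Orthonormal 𝕜 u) : E →L[𝕜] F :=
  (hu.orthogonalFamily.linearIsometry.comp b.repr.toLinearIsometry).toContinuousLinearMap

lemma orthonormalIsometry_apply (b : HilbertBasis ι 𝕜 E) {u : ι → F} (hu : Orthonormal 𝕜 u)
    (i : ι) : orthonormalIsometry b hu (b i) = u i := by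
  classical
  simp only [orthonormalIsometry, LinearIsometry.coe_toContinuousLinearMap,
    LinearIsometry.coe_comp, Function.comp_apply, LinearIsometryEquiv.coe_toLinearIsometry,
    b.repr_self]
  rw [OrthogonalFamily.linearIsometry_apply_single, LinearIsometry.toSpanSingleton_apply, one_smul]

lemma adjoint_orthonormalIsometry_mul [CompleteSpace E] (b : HilbertBasis ι 𝕜 E) {J : Type*}
    [DecidableEq J] {u : J → ι → E} (hu : Orthonormal 𝕜 fun p : J × ι => u p.1 p.2)
    (hu' : ∀ j, Orthonormal 𝕜 (u j)) (j k : J) :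
    star (orthonormalIsometry b (hu' j)) * orthonormalIsometry b (hu' k) =
      if j = k then 1 else 0 := by
  classical
  refine hilbertBasis_clm_ext b fun l => hilbertBasis_eq_of_forall_inner b fun i => ?_
  have hinner := orthonormal_iff_ite.1 hu (j, i) (k, l)
  by_cases hjk : j = k <;>
    simp_all [ContinuousLinearMap.star_eq_adjoint, ContinuousLinearMap.adjoint_inner_right,
      orthonormalIsometry_apply, orthonormal_iff_ite.1 b.orthonormal]

end BasisIsometry

section CommutantIsometries

open InnerProductSpace

variable {K H : Type*} [NormedAddCommGroup K] [InnerProductSpace ℂ K] [CompleteSpace K]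
  [NormedAddCommGroup H] [InnerProductSpace ℂ H] [CompleteSpace H]
  (ρ : (K →L[ℂ] K) →⋆ₐ[ℂ] (H →L[ℂ] H))

lemma map_rankOne_map_rankOne (x y z w : K) (h : H) :
    ρ (rankOne ℂ x y) (ρ (rankOne ℂ z w) h) = inner ℂ y z • ρ (rankOne ℂ x w) h := by
  rw [← mul_apply_eq_comp, ← map_mul, ContinuousLinearMap.mul_def,
    rankOne_comp_rankOne, map_smul, smul_apply]

lemma inner_map_rankOne_left (x y : K) (h k : H) :
    inner ℂ (ρ (rankOne ℂ x y) h) k = inner ℂ h (ρ (rankOne ℂ y x) k) := by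
  have hstar : star (rankOne ℂ x y) = rankOne ℂ y x := by
    simp [ContinuousLinearMap.star_eq_adjoint]
  rw [← hstar, map_star, ContinuousLinearMap.star_eq_adjoint,
    ContinuousLinearMap.adjoint_inner_right]

/-- The map `x ↦ ρ(x ⊗ e*) h` embedding `K` into the `B(K)`-invariant subspace generated by `h`,
with `x ⊗ e*` the rank one operator `k ↦ ⟨e, k⟩ x`. -/
def rankOneSlice (e : K) (h : H) : K →L[ℂ] H :=
  ContinuousLinearMap.apply ℂ H h ∘L ⟨ρ.toAlgHom.toLinearMap, map_continuous ρ⟩ ∘L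
    (rankOne ℂ : K →L[ℂ] K →L⋆[ℂ] K →L[ℂ] K).flip e

lemma rankOneSlice_apply (e : K) (h : H) (x : K) :
    rankOneSlice ρ e h x = ρ (rankOne ℂ x e) h := rfl

lemma apply_rankOneSlice (e : K) (h : H) (g : K →L[ℂ] K) (x : K) :
    ρ g (rankOneSlice ρ e h x) = rankOneSlice ρ e h (g x) := by
  rw [rankOneSlice_apply, rankOneSlice_apply, ← mul_apply_eq_comp, ← map_mul,
    ContinuousLinearMap.mul_def, comp_rankOne]

/-- The multiplicity space of a representation of `B(K)`, realized as the range of the projection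
`ρ(e ⊗ e*)` for a unit vector `e`. -/
def multiplicitySpace (e : K) : Submodule ℂ H := (ρ (rankOne ℂ e e) - 1).ker

variable {ρ} {e : K}

lemma mem_multiplicitySpace {h : H} : h ∈ multiplicitySpace ρ e ↔ ρ (rankOne ℂ e e) h = h := by
  simp [multiplicitySpace, sub_eq_zero]

instance : CompleteSpace (multiplicitySpace ρ e) :=
  (ρ (rankOne ℂ e e) - 1).isClosed_ker.completeSpace_coe

lemma map_rankOne_mem_multiplicitySpace (he : ‖e‖ = 1) (x : K) (h : H) :
    ρ (rankOne ℂ e x) h ∈ multiplicitySpace ρ e := by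
  simp [mem_multiplicitySpace, map_rankOne_map_rankOne, he]

lemma inner_rankOneSlice (x y : K) (h k : multiplicitySpace ρ e) :
    inner ℂ (rankOneSlice ρ e (h : H) x) (rankOneSlice ρ e (k : H) y) =
      inner ℂ x y * inner ℂ h k := by
  rw [rankOneSlice_apply, rankOneSlice_apply, inner_map_rankOne_left, map_rankOne_map_rankOne,
    mem_multiplicitySpace.1 k.2, inner_smul_right, Submodule.coe_inner]

lemma infinite_hilbertBasis_index {E ι : Type*} [NormedAddCommGroup E] [InnerProductSpace ℂ E]
    (hE : ¬ FiniteDimensional ℂ E) (b : HilbertBasis ι ℂ E) : Infinite ι := by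
  by_contra hfin
  rw [not_infinite_iff_finite] at hfin
  have := Fintype.ofFinite ι
  exact hE b.toOrthonormalBasis.toBasis.finiteDimensional_of_finite

lemma not_finiteDimensional_multiplicitySpace (hK : ¬ FiniteDimensional ℂ K) {ξ : H}
    (hξ : ∀ x, ρ x ξ = 0 → x = 0) (he : ‖e‖ = 1) :
    ¬ FiniteDimensional ℂ (multiplicitySpace ρ e) := by
  obtain ⟨s, b, -⟩ := exists_hilbertBasis ℂ K
  have := infinite_hilbertBasis_index hK b
  let j : K →+ multiplicitySpace ρ e :=
    { toFun x := ⟨ρ (rankOne ℂ e x) ξ, map_rankOne_mem_multiplicitySpace he x ξ⟩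
      map_zero' := by simp
      map_add' x y := by ext; simp }
  have hj : Function.Injective j := by
    refine (injective_iff_map_eq_zero j).2 fun x hx => ?_
    have hzero : rankOne ℂ e x = 0 := hξ _ congr(($hx : H))
    refine (rankOne_eq_zero.1 hzero).resolve_left fun h => ?_
    simp [h] at he
  have hindep : LinearIndependent ℂ (j ∘ b) :=
    b.orthonormal.linearIndependent.map_of_injective_injectiveₛ star j star_injective hj
      fun r x => by ext; simp [j]
  intro hfin
  have := hindep.finite
  exact not_finite s

variable {M : VonNeumannAlgebra H}

/- The joint kernel of the operators `ρ(e ⊗ x*)` is invariant under `M'`, so its projection lies in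
`M`; its preimage under `ρ` is annihilated by every `e ⊗ x*`. -/
lemma eq_zero_of_forall_map_rankOne_eq_zero (hρ : Function.Injective ρ)
    (hM : (M : Set (H →L[ℂ] H)) = Set.range ρ) (he : e ≠ 0) {h : H}
    (hh : ∀ x, ρ (rankOne ℂ e x) h = 0) : h = 0 := by
  let N : Submodule ℂ H := ⨅ x, (ρ (rankOne ℂ e x)).ker
  have hmem (k : H) : k ∈ N ↔ ∀ x, ρ (rankOne ℂ e x) k = 0 := by simp [N, Submodule.mem_iInf]
  have : CompleteSpace N := by
    refine IsClosed.completeSpace_coe (hs := ?_)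
    rw [Submodule.coe_iInf]
    exact isClosed_iInter fun x => (ρ (rankOne ℂ e x)).isClosed_ker
  have hNM : N.starProjection ∈ M := by
    rw [VonNeumannAlgebra.IsStarProjection.mem_iff isStarProjection_starProjection]
    intro y hy
    rw [Submodule.range_starProjection, Module.End.mem_invtSubmodule]
    intro k hk
    rw [Submodule.mem_comap, hmem]
    intro x
    have hcomm := VonNeumannAlgebra.mem_commutant_iff.1 hy (ρ (rankOne ℂ e x))
      (hM.ge ⟨_, rfl⟩)
    simpa [(hmem k).1 hk x] using congr($hcomm k)
  obtain ⟨p, hp⟩ : N.starProjection ∈ Set.range ρ := hM.le hNM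
  have hann (x : K) : rankOne ℂ e x * p = 0 := hρ <| by
    ext k
    simpa [hp] using (hmem _).1 (N.starProjection_apply_mem k) x
  have hp0 : p = 0 := by
    ext y
    refine ext_inner_left ℂ fun x => ?_
    simpa [he] using congr($(hann x) y)
  have hfix := Submodule.starProjection_eq_self_iff.2 ((hmem h).2 hh)
  simpa [← hp, hp0] using hfix.symm

section TensorBasis

variable {s W : Type*} (b : HilbertBasis s ℂ K) (w : HilbertBasis W ℂ (multiplicitySpace ρ e))

lemma orthonormal_rankOneSlice :
    Orthonormal ℂ fun p : s × W => rankOneSlice ρ e (w p.2 : H) (b p.1) := by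
  classical
  rw [orthonormal_iff_ite]
  rintro ⟨i, α⟩ ⟨j, β⟩
  by_cases hij : i = j <;>
    simp [inner_rankOneSlice, orthonormal_iff_ite.1 b.orthonormal,
      orthonormal_iff_ite.1 w.orthonormal, b.orthonormal.1, hij]

lemma orthogonal_span_rankOneSlice_eq_bot (hρ : Function.Injective ρ)
    (hM : (M : Set (H →L[ℂ] H)) = Set.range ρ) (he : ‖e‖ = 1) :
    (Submodule.span ℂ (Set.range fun p : s × W => rankOneSlice ρ e (w p.2 : H) (b p.1)))ᗮ = ⊥ := by
  refine eq_bot_iff.2 fun h hh => ?_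
  rw [Submodule.mem_orthogonal] at hh
  have hα (α : W) (x : K) : inner ℂ (rankOneSlice ρ e (w α : H) x) h = 0 := by
    have hzero : innerSL ℂ h ∘L rankOneSlice ρ e (w α : H) = 0 :=
      hilbertBasis_clm_ext b fun i => by
        simpa using inner_eq_zero_symm.1 (hh _ (Submodule.subset_span ⟨(i, α), rfl⟩))
    exact inner_eq_zero_symm.1 (by simpa using congr($hzero x))
  have he0 : e ≠ 0 := by rintro rfl; simp at he
  refine eq_zero_of_forall_map_rankOne_eq_zero hρ hM he0 fun x => ?_
  suffices (⟨_, map_rankOne_mem_multiplicitySpace he x h⟩ : multiplicitySpace ρ e) = 0 from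
    congr(($this : H))
  refine hilbertBasis_eq_of_forall_inner w fun α => ?_
  rw [inner_zero_right, Submodule.coe_inner, ← inner_map_rankOne_left]
  exact hα α x

end TensorBasis

/- `H` is `K ⊗ L` with `L` the multiplicity space, and `M' = 1 ⊗ B(L)` with `L` of infinite
dimension. -/
theorem exists_orthogonal_isometries_mem_commutant (hK : ¬ FiniteDimensional ℂ K)
    (hM : (M : Set (H →L[ℂ] H)) = Set.range ρ) {ξ : H} (hξ : ∀ x, ρ x ξ = 0 → x = 0) :
    ∃ v : ℕ → H →L[ℂ] H, (∀ k, v k ∈ M.commutant) ∧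
      ∀ j k, star (v j) * v k = if j = k then 1 else 0 := by
  classical
  have hρ : Function.Injective ρ := (injective_iff_map_eq_zero ρ).2 fun x hx => hξ x (by simp [hx])
  obtain ⟨s, b, -⟩ := exists_hilbertBasis ℂ K
  have := infinite_hilbertBasis_index hK b
  obtain ⟨i₀⟩ : Nonempty s := inferInstance
  have he : ‖b i₀‖ = 1 := b.orthonormal.1 i₀
  obtain ⟨W, w, -⟩ := exists_hilbertBasis ℂ (multiplicitySpace ρ (b i₀))
  have := infinite_hilbertBasis_index (not_finiteDimensional_multiplicitySpace hK hξ he) w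
  obtain ⟨σ⟩ : Nonempty (ℕ × W ≃ W) := Cardinal.eq.1 (by simp)
  let c := HilbertBasis.mkOfOrthogonalEqBot (orthonormal_rankOneSlice b w)
    (orthogonal_span_rankOneSlice_eq_bot b w hρ hM he)
  have hc (i : s) (α : W) : c (i, α) = rankOneSlice ρ (b i₀) (w α : H) (b i) := by simp [c]
  let u (k : ℕ) (p : s × W) : H := c (p.1, σ (k, p.2))
  have hu : Orthonormal ℂ fun q : ℕ × s × W => u q.1 q.2 :=
    c.orthonormal.comp _ (by rintro ⟨k, i, α⟩ ⟨l, j, β⟩ h; simp_all)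
  have hu' (k : ℕ) : Orthonormal ℂ (u k) := hu.comp _ (Prod.mk_right_injective k)
  refine ⟨fun k => orthonormalIsometry c (hu' k), fun k => ?_,
    adjoint_orthonormalIsometry_mul c hu hu'⟩
  have hslice (α : W) : orthonormalIsometry c (hu' k) ∘L rankOneSlice ρ (b i₀) (w α : H) =
      rankOneSlice ρ (b i₀) (w (σ (k, α)) : H) := hilbertBasis_clm_ext b fun i => by
    simp [← hc, orthonormalIsometry_apply, u]
  rw [VonNeumannAlgebra.mem_commutant_iff]
  intro g hg
  obtain ⟨x, rfl⟩ := hM.le hg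
  refine hilbertBasis_clm_ext c fun ⟨i, α⟩ => ?_
  have hright := congr($(hslice α) (x (b i)))
  simp only [ContinuousLinearMap.coe_comp, Function.comp_apply] at hright
  simp only [mul_apply_eq_comp, orthonormalIsometry_apply, u]
  rw [hc, hc, apply_rankOneSlice, apply_rankOneSlice, hright]

end CommutantIsometries

/-! ### Norming rows -/

section WeakDensity

open ContinuousLinearMapWOT

variable {H : Type*} [NormedAddCommGroup H] [InnerProductSpace ℂ H]

lemma IsWeaklyDenseIn.le_of_forall_le {B N : Set (H →L[ℂ] H)} (hB : IsWeaklyDenseIn B N)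
    {F : (H →WOT[ℂ] H) → ℝ} (hF : Continuous F) {r : ℝ} (h : ∀ c ∈ B, F (ofCLM c) ≤ r)
    {x : H →L[ℂ] H} (hx : x ∈ N) : F (ofCLM x) ≤ r := by
  refine closure_minimal ?_ (isClosed_le hF continuous_const) (hB.2 x hx)
  rintro _ ⟨c, hc, rfl⟩
  exact h c hc

variable [CompleteSpace H]

/- For a convex set, weak and norm closures coincide. The adjoint in the second coordinate is
weakly continuous, so a functional on `H × H` separating `(x η, x* ζ)` from the pairs
`(c η, c* ζ)` would be a weak operator continuous functional separating `x` from `B`. -/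
lemma IsWeaklyDenseIn.mem_closure_image {B : NonUnitalStarSubalgebra ℂ (H →L[ℂ] H)}
    {N : Set (H →L[ℂ] H)} (hB : IsWeaklyDenseIn (B : Set (H →L[ℂ] H)) N) {x : H →L[ℂ] H}
    (hx : x ∈ N) (η ζ : H) :
    (x η, star x ζ) ∈ closure ((fun c : H →L[ℂ] H => (c η, star c ζ)) '' (B : Set _)) := by
  have hconv : Convex ℝ ((fun c : H →L[ℂ] H => (c η, star c ζ)) '' (B : Set _)) := by
    rintro _ ⟨c, hc, rfl⟩ _ ⟨d, hd, rfl⟩ s t - - -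
    exact ⟨(s : ℂ) • c + (t : ℂ) • d,
      add_mem (SMulMemClass.smul_mem _ hc) (SMulMemClass.smul_mem _ hd), by simp⟩
  by_contra hn
  obtain ⟨f, u, hlt, hgt⟩ :=
    RCLike.geometric_hahn_banach_closed_point (𝕜 := ℂ) hconv.closure isClosed_closure hn
  let f₁ : StrongDual ℂ H := f.comp (ContinuousLinearMap.inl ℂ H H)
  let f₂ : StrongDual ℂ H := f.comp (ContinuousLinearMap.inr ℂ H H)
  let r := (InnerProductSpace.toDual ℂ H).symm f₂
  have hf (c : H →L[ℂ] H) :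
      RCLike.re (f (c η, star c ζ)) = (f₁ (c η)).re + (inner ℂ ζ (c r)).re := by
    have hsplit : (c η, star c ζ) = (c η, 0) + (0, star c ζ) := by simp
    have hr : f (0, star c ζ) = inner ℂ r (star c ζ) := by
      simp [r, InnerProductSpace.toDual_symm_apply, f₂]
    rw [hsplit, map_add, RCLike.re_eq_complex_re, Complex.add_re, hr,
      ContinuousLinearMap.star_eq_adjoint, ContinuousLinearMap.adjoint_inner_right,
      ← inner_conj_symm, Complex.conj_re]
    rfl
  have hcont : Continuous fun T : H →WOT[ℂ] H =>
      (f₁ (T η)).re + ((InnerProductSpace.toDual ℂ H ζ) (T r)).re :=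
    (Complex.continuous_re.comp (continuous_dual_apply η f₁)).add
      (Complex.continuous_re.comp (continuous_dual_apply r _))
  have hle := hB.le_of_forall_le hcont (r := u)
    (fun c hc => (hf c).ge.trans (hlt _ (subset_closure ⟨c, hc, rfl⟩)).le) hx
  rw [hf] at hgt
  exact hgt.not_ge hle

lemma IsWeaklyDenseIn.exists_norm_sub_lt {B : NonUnitalStarSubalgebra ℂ (H →L[ℂ] H)}
    {N : Set (H →L[ℂ] H)} (hB : IsWeaklyDenseIn (B : Set (H →L[ℂ] H)) N) {x : H →L[ℂ] H}
    (hx : x ∈ N) (η ζ : H) {ε : ℝ} (hε : 0 < ε) :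
    ∃ c ∈ B, ‖x η - c η‖ < ε ∧ ‖star x ζ - star c ζ‖ < ε := by
  obtain ⟨_, ⟨c, hc, rfl⟩, hd⟩ := Metric.mem_closure_iff.1 (hB.mem_closure_image hx η ζ) ε hε
  rw [Prod.dist_eq, max_lt_iff, dist_eq_norm, dist_eq_norm] at hd
  exact ⟨c, hc, hd⟩

end WeakDensity

section ContractiveRows

variable {B : Type*} [NonUnitalCStarAlgebra B]
  {H : Type*} [NormedAddCommGroup H] [InnerProductSpace ℂ H]

/-- The contractive rows over `B`, acting through `τ`, are norming for columns of vectors of `H`.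
This replaces the action of row isometries `(v₁, …, vₙ)`, `vⱼ* vₖ = δⱼₖ`, when the `vₖ` are only
available in a closure of `τ(B)`. -/
def HasNormingRows (τ : B → H →L[ℂ] H) : Prop :=
  ∀ (ι : Type) [Fintype ι] (η : ι → H) (ε : ℝ), 0 < ε →
    ∃ c : ι → B, ‖∑ k, c k * star (c k)‖ ≤ 1 ∧
      √(∑ k, ‖η k‖ ^ 2) ≤ ‖∑ k, τ (c k) (η k)‖ + ε

/- `g = s / (1 + s)`, so that `1 - g = (1 + s)⁻¹`. -/
lemma exists_isSelfAdjoint_resolvent [PartialOrder B] [StarOrderedRing B] {s : B} (hs : 0 ≤ s) :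
    ∃ g : B, IsSelfAdjoint g ∧ g + s * g = s ∧ ‖g - g * g‖ ≤ 1 / 4 := by
  have hq : ∀ t ∈ quasispectrum ℝ s, 0 ≤ t := quasispectrum_nonneg_of_nonneg s hs
  have hc : ContinuousOn (fun t : ℝ => t / (1 + t)) (quasispectrum ℝ s) :=
    continuousOn_id.div (by fun_prop) fun t ht => by have := hq t ht; positivity
  refine ⟨cfcₙ (fun t : ℝ => t / (1 + t)) s, IsSelfAdjoint.cfcₙ, ?_, ?_⟩
  · nth_rw 2 4 [← cfcₙ_id' ℝ s]
    rw [← cfcₙ_mul _ _ s (by fun_prop) (by simp) hc (by simp),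
      ← cfcₙ_add (fun t : ℝ => t / (1 + t)) (fun t => t * (t / (1 + t))) s hc (by simp)
        (continuousOn_id.mul hc) (by simp)]
    refine cfcₙ_congr fun t ht => ?_
    have := hq t ht
    field_simp
  · rw [← cfcₙ_mul _ _ s hc (by simp) hc (by simp),
      ← cfcₙ_sub (fun t : ℝ => t / (1 + t)) (fun t => t / (1 + t) * (t / (1 + t))) s hc (by simp)
        (hc.mul hc) (by simp)]
    refine norm_cfcₙ_le fun t ht => ?_
    have ht0 := hq t ht
    have hform : t / (1 + t) - t / (1 + t) * (t / (1 + t)) = t / (1 + t) ^ 2 := by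
      field_simp; ring
    rw [hform, Real.norm_of_nonneg (by positivity), div_le_div_iff₀ (by positivity) (by norm_num)]
    nlinarith [sq_nonneg (1 - t)]

variable {ι : Type*} [Fintype ι]

lemma norm_sub_resolvent_apply_le {s g : H →L[ℂ] H}
    (hs : ∀ y, 0 ≤ RCLike.re (inner ℂ (s y) y)) (hg : g + s * g = s) (x : H) :
    ‖x - g x‖ ≤ ‖x‖ := by
  set y := x - g x with hy
  have hx : x = y + s y := by
    have := congr($hg x)
    simp only [add_apply, mul_apply_eq_comp] at this
    rw [hy, map_sub, ← this]
    abel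
  have hsq : ‖y‖ ^ 2 ≤ ‖x‖ * ‖y‖ := by
    refine le_trans ?_ (re_inner_le_norm (𝕜 := ℂ) x y)
    nth_rw 1 [hx]
    rw [inner_add_left, map_add, inner_self_eq_norm_sq]
    linarith [hs y]
  by_contra! hlt
  nlinarith [norm_nonneg x]

variable [CompleteSpace H]

lemma re_inner_sum_mul_star_apply (T : ι → H →L[ℂ] H) (y : H) :
    RCLike.re (inner ℂ ((∑ k, T k * star (T k)) y) y) = ∑ k, ‖star (T k) y‖ ^ 2 := by
  rw [sum_apply, sum_inner, map_sum]
  refine Finset.sum_congr rfl fun k _ => ?_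
  rw [mul_apply_eq_comp, ContinuousLinearMap.star_eq_adjoint,
    ← ContinuousLinearMap.adjoint_inner_right, inner_self_eq_norm_sq]

lemma norm_sum_apply_sq_le {T : ι → H →L[ℂ] H} (hT : ‖∑ k, T k * star (T k)‖ ≤ 1) (w : ι → H) :
    ‖∑ k, T k (w k)‖ ^ 2 ≤ ∑ k, ‖w k‖ ^ 2 := by
  set y := ∑ k, T k (w k) with hy
  have hadj : ∑ k, ‖star (T k) y‖ ^ 2 ≤ ‖y‖ ^ 2 := by
    rw [← re_inner_sum_mul_star_apply]
    calc RCLike.re (inner ℂ ((∑ k, T k * star (T k)) y) y)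
        ≤ ‖(∑ k, T k * star (T k)) y‖ * ‖y‖ := re_inner_le_norm _ _
      _ ≤ 1 * ‖y‖ * ‖y‖ := by gcongr; exact ContinuousLinearMap.le_of_opNorm_le _ hT y
      _ = ‖y‖ ^ 2 := by ring
  have hpair : ‖y‖ ^ 2 = ∑ k, RCLike.re (inner ℂ (w k) (star (T k) y)) := by
    simp_rw [ContinuousLinearMap.star_eq_adjoint, ContinuousLinearMap.adjoint_inner_right]
    rw [← map_sum, ← sum_inner, ← hy, inner_self_eq_norm_sq]
  have hle : ‖y‖ ^ 2 ≤ ∑ k, (‖w k‖ ^ 2 + ‖star (T k) y‖ ^ 2) / 2 := by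
    rw [hpair]
    refine Finset.sum_le_sum fun k _ => (re_inner_le_norm _ _).trans ?_
    linarith [two_mul_le_add_sq ‖w k‖ ‖star (T k) y‖]
  rw [← Finset.sum_div, Finset.sum_add_distrib] at hle
  linarith

lemma exists_resolvent_row (c : ι → B) :
    ∃ g : B, g + g * ∑ k, c k * star (c k) = ∑ k, c k * star (c k) ∧
      g + (∑ k, c k * star (c k)) * g = ∑ k, c k * star (c k) ∧
      ‖∑ k, (2 : ℂ) • (c k - g * c k) * star ((2 : ℂ) • (c k - g * c k))‖ ≤ 1 := by
  let _ := CStarAlgebra.spectralOrder B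
  have := CStarAlgebra.spectralOrderedRing B
  obtain ⟨g, hgsa, hsg, hnorm⟩ :=
    exists_isSelfAdjoint_resolvent (Finset.sum_nonneg fun k _ => mul_star_self_nonneg (c k))
  set s := ∑ k, c k * star (c k) with hs
  have hgs : g + g * s = s := by
    have hsa : star s = s := by simp [hs]
    simpa [hgsa.star_eq, hsa] using congr(star $hsg)
  refine ⟨g, hgs, hsg, ?_⟩
  have hterm (k : ι) : (2 : ℂ) • (c k - g * c k) * star ((2 : ℂ) • (c k - g * c k)) =
      (4 : ℂ) • (c k * star (c k) - g * (c k * star (c k)) -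
        (c k * star (c k) - g * (c k * star (c k))) * g) := by
    simp only [star_smul, star_sub, star_mul, hgsa.star_eq, smul_mul_smul_comm]
    norm_num
    noncomm_ring
  have hsum : ∑ k, (2 : ℂ) • (c k - g * c k) * star ((2 : ℂ) • (c k - g * c k)) =
      (4 : ℂ) • (g - g * g) := by
    simp_rw [hterm, ← Finset.smul_sum, Finset.sum_sub_distrib, ← Finset.sum_mul,
      Finset.sum_sub_distrib, ← Finset.mul_sum, ← hs]
    rw [← eq_sub_of_add_eq hgs]
  rw [hsum, norm_smul]
  norm_num
  linarith

variable (τ : B →⋆ₙₐ[ℂ] (H →L[ℂ] H))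

/- The row `(2 (1 + s)⁻¹ cₖ)` with `s = ∑ cₖ cₖ*`: if the `cₖ` resemble isometries with orthogonal
ranges then `s ζ ≈ ζ`, and `2 (1 + s)⁻¹ ζ ≈ ζ`. -/
lemma exists_contractive_row (c : ι → B) {η : ι → H} {ζ : H} {δ : ℝ} (hδ : 0 ≤ δ)
    (hζ : ‖ζ - ∑ k, τ (c k) (η k)‖ ≤ δ) (hη : ∑ k, ‖star (τ (c k)) ζ - η k‖ ^ 2 ≤ δ ^ 2) :
    ∃ c' : ι → B, ‖∑ k, c' k * star (c' k)‖ ≤ 1 ∧ ‖ζ - ∑ k, τ (c' k) (η k)‖ ≤ 2 * δ := by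
  obtain ⟨g, hgs, hsg, hrow⟩ := exists_resolvent_row c
  set s := ∑ k, c k * star (c k) with hs
  refine ⟨fun k => (2 : ℂ) • (c k - g * c k), hrow, ?_⟩
  set c' : ι → B := fun k => (2 : ℂ) • (c k - g * c k)
  have hτs : τ s = ∑ k, τ (c k) * star (τ (c k)) := by simp [hs, map_star]
  have hτc (k : ι) (x : H) :
      τ (c' k) x = (2 : ℂ) • (τ (c k) x - τ g (τ (c k) x)) := by simp [c']
  set e := ζ - ∑ k, τ (c k) (η k) with he
  set w : ι → H := fun k => star (τ (c k)) ζ - η k with hw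
  have hdecomp : ζ - ∑ k, τ (c' k) (η k) = (e - τ g e) + (2⁻¹ : ℂ) • ∑ k, τ (c' k) (w k) := by
    have hsum : ∑ k, τ (c k) (star (τ (c k)) ζ) = τ s ζ := by simp [hτs]
    have hτgs : τ g (τ s ζ) = τ s ζ - τ g ζ := by
      rw [eq_sub_iff_add_eq', ← mul_apply_eq_comp, ← add_apply, ← map_mul, ← map_add, hgs]
    simp only [hτc, ← Finset.smul_sum, smul_smul, Finset.sum_sub_distrib, ← map_sum, hw, map_sub,
      he, hsum, hτgs]
    rw [inv_mul_cancel₀ two_ne_zero, one_smul, two_smul]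
    abel
  have hres : ‖e - τ g e‖ ≤ δ := by
    refine (norm_sub_resolvent_apply_le (s := τ s) (fun y => ?_) ?_ e).trans hζ
    · rw [hτs, re_inner_sum_mul_star_apply]; positivity
    · rw [← map_mul, ← map_add, hsg]
  have hw' : ‖∑ k, τ (c' k) (w k)‖ ≤ δ := by
    refine (abs_le_of_sq_le_sq' ((norm_sum_apply_sq_le ?_ w).trans hη) hδ).2
    simp only [← map_star, ← map_mul, ← map_sum]
    exact (NonUnitalStarAlgHom.norm_apply_le τ _).trans hrow
  rw [hdecomp]
  refine (norm_add_le _ _).trans ?_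
  rw [norm_smul]
  norm_num
  linarith

lemma star_apply_sum_of_star_mul [DecidableEq ι] {v : ι → H →L[ℂ] H}
    (hv : ∀ j k, star (v j) * v k = if j = k then 1 else 0) (η : ι → H) (j : ι) :
    star (v j) (∑ k, v k (η k)) = η j := by
  rw [map_sum, Finset.sum_eq_single j (fun k _ hk => ?_) (by simp)]
  · simpa using congr($(hv j j) (η j))
  · simpa [hk.symm] using congr($(hv j k) (η k))

lemma norm_sum_apply_of_star_mul [DecidableEq ι] {v : ι → H →L[ℂ] H}
    (hv : ∀ j k, star (v j) * v k = if j = k then 1 else 0) (η : ι → H) :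
    ‖∑ k, v k (η k)‖ = √(∑ k, ‖η k‖ ^ 2) := by
  rw [eq_comm, Real.sqrt_eq_iff_eq_sq (by positivity) (norm_nonneg _),
    ← inner_self_eq_norm_sq (𝕜 := ℂ), inner_sum, map_sum]
  refine Finset.sum_congr rfl fun k _ => ?_
  rw [← ContinuousLinearMap.adjoint_inner_left, ← ContinuousLinearMap.star_eq_adjoint,
    star_apply_sum_of_star_mul hv, inner_self_eq_norm_sq]

lemma IsWeaklyDenseIn.exists_row_approx {B : NonUnitalStarSubalgebra ℂ (H →L[ℂ] H)}
    {N : Set (H →L[ℂ] H)} (hB : IsWeaklyDenseIn (B : Set (H →L[ℂ] H)) N) {x : ι → H →L[ℂ] H}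
    (hx : ∀ k, x k ∈ N) (η : ι → H) (ζ : H) {ε : ℝ} (hε : 0 < ε) :
    ∃ c : ι → B, ‖∑ k, x k (η k) - ∑ k, (c k : H →L[ℂ] H) (η k)‖ ≤ ε ∧
      ∑ k, ‖star (x k) ζ - star (c k : H →L[ℂ] H) ζ‖ ^ 2 ≤ ε ^ 2 := by
  set n : ℝ := (Fintype.card ι : ℝ)
  have hn0 : 0 ≤ n := Nat.cast_nonneg _
  obtain ⟨δ, hδ, hnδ⟩ : ∃ δ > 0, (n + 1) * δ = ε :=
    ⟨ε / (n + 1), by positivity, mul_div_cancel₀ ε (by positivity)⟩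
  choose c hcB hc hc' using fun k => hB.exists_norm_sub_lt (hx k) (η k) ζ hδ
  refine ⟨fun k => ⟨c k, hcB k⟩, ?_, ?_⟩
  · calc ‖∑ k, x k (η k) - ∑ k, c k (η k)‖ ≤ ∑ k, ‖x k (η k) - c k (η k)‖ := by
          rw [← Finset.sum_sub_distrib]; exact norm_sum_le _ _
      _ ≤ ∑ _k : ι, δ := Finset.sum_le_sum fun k _ => (hc k).le
      _ = n * δ := by rw [Finset.sum_const, Finset.card_univ, nsmul_eq_mul]
      _ ≤ ε := by linarith
  · calc ∑ k, ‖star (x k) ζ - star (c k) ζ‖ ^ 2 ≤ ∑ _k : ι, δ ^ 2 :=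
          Finset.sum_le_sum fun k _ => by gcongr; exact (hc' k).le
      _ = n * δ ^ 2 := by rw [Finset.sum_const, Finset.card_univ, nsmul_eq_mul]
      _ ≤ ε ^ 2 := by rw [← hnδ, mul_pow]; gcongr; nlinarith

theorem hasNormingRows_subtype {B : NonUnitalStarSubalgebra ℂ (H →L[ℂ] H)}
    [IsClosed (B : Set (H →L[ℂ] H))] {N : Set (H →L[ℂ] H)}
    (hB : IsWeaklyDenseIn (B : Set (H →L[ℂ] H)) N) {v : ℕ → H →L[ℂ] H} (hvN : ∀ k, v k ∈ N)
    (hv : ∀ j k, star (v j) * v k = if j = k then 1 else 0) :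
    HasNormingRows (fun b : B => (b : H →L[ℂ] H)) := by
  classical
  intro ι _ η ε hε
  let f : ι ↪ ℕ := (Fintype.equivFin ι).toEmbedding.trans Fin.valEmbedding
  have hvf (j k : ι) : star (v (f j)) * v (f k) = if j = k then 1 else 0 := by
    simp only [hv, f.injective.eq_iff]
  set ζ := ∑ k, v (f k) (η k)
  obtain ⟨c, hcζ, hcη⟩ := hB.exists_row_approx (fun k => hvN (f k)) η ζ (half_pos hε)
  have hcη' : ∑ k, ‖star (c k : H →L[ℂ] H) ζ - η k‖ ^ 2 ≤ (ε / 2) ^ 2 := by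
    refine (Finset.sum_congr rfl fun k _ => ?_).trans_le hcη
    rw [star_apply_sum_of_star_mul hvf, norm_sub_rev]
  obtain ⟨c', hrow, happrox⟩ := exists_contractive_row (NonUnitalStarSubalgebraClass.subtype B)
    c (half_pos hε).le hcζ hcη'
  refine ⟨c', hrow, ?_⟩
  rw [← norm_sum_apply_of_star_mul hvf η]
  calc ‖ζ‖ ≤ ‖∑ k, (c' k : H →L[ℂ] H) (η k)‖ + 2 * (ε / 2) :=
        norm_le_norm_add_const_of_dist_le ((dist_eq_norm _ _).trans_le happrox)
    _ = ‖∑ k, (c' k : H →L[ℂ] H) (η k)‖ + ε := by ring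

end ContractiveRows

/-! ### A dominating positive functional -/

section RowDomination

open scoped ComplexOrder

variable {D : Type*} [CStarAlgebra D] [PartialOrder D] [StarOrderedRing D]

lemma star_sum_mul_mul_sum_mul_le {κ : Type*} [Fintype κ] {c : κ → D}
    (hc : ‖∑ k, c k * star (c k)‖ ≤ 1) (x : κ → D) :
    star (∑ k, c k * x k) * ∑ k, c k * x k ≤ ∑ k, star (x k) * x k := by
  set y := ∑ k, c k * x k with hy
  have hpos : 0 ≤ ∑ k, star (x k - star (c k) * y) * (x k - star (c k) * y) :=
    Finset.sum_nonneg fun k _ => star_mul_self_nonneg _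
  have hexpand : ∑ k, star (x k - star (c k) * y) * (x k - star (c k) * y) =
      ∑ k, star (x k) * x k - star y * y -
        (star y * y - star y * (∑ k, c k * star (c k)) * y) := by
    have hterm (k : κ) : star (x k - star (c k) * y) * (x k - star (c k) * y) =
        star (x k) * x k - star (c k * x k) * y -
          (star y * (c k * x k) - star y * (c k * star (c k)) * y) := by
      simp only [star_sub, star_mul, star_star]
      noncomm_ring
    simp_rw [hterm, Finset.sum_sub_distrib, ← Finset.sum_mul, ← Finset.mul_sum, ← star_sum, ← hy]
  have hrow : star y * (∑ k, c k * star (c k)) * y ≤ star y * y := by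
    have hle_one := (CStarAlgebra.norm_le_one_iff_of_nonneg _
      (Finset.sum_nonneg fun k _ => mul_star_self_nonneg (c k))).1 hc
    simpa using star_left_conjugate_le_conjugate hle_one y
  rw [hexpand, sub_nonneg] at hpos
  exact sub_nonneg.1 ((sub_nonneg.2 hrow).trans hpos)

variable {B : Type*} [CStarAlgebra B]
  {H : Type*} [NormedAddCommGroup H] [InnerProductSpace ℂ H] [CompleteSpace H]
  {Φ : D →ₐ[ℂ] (H →L[ℂ] H)} {j : B →⋆ₐ[ℂ] D} {τ : B →⋆ₐ[ℂ] (H →L[ℂ] H)} {C : ℝ}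

lemma norm_map_mul_apply_sq_le (hΦ : ∀ x, ‖Φ x‖ ≤ C * ‖x‖) (hτ : ∀ b, Φ (j b) = τ b) {y : D}
    (hy : star y * y ≤ 1) {s : B} (hs : IsSelfAdjoint s) (ξ : H) :
    ‖Φ (y * j s) ξ‖ ^ 2 ≤ C ^ 2 * RCLike.re (inner ℂ (τ (s * s) ξ) ξ) := by
  have hynorm : ‖y‖ ≤ 1 := by
    rw [← sq_le_one_iff₀ (norm_nonneg _), sq, ← CStarRing.norm_star_mul_self]
    exact (CStarAlgebra.norm_le_one_iff_of_nonneg _ (star_mul_self_nonneg y)).2 hy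
  have hΦy : ‖Φ y‖ ≤ |C| := calc
    ‖Φ y‖ ≤ |C| * ‖y‖ := (hΦ y).trans (by gcongr; exact le_abs_self C)
    _ ≤ |C| := mul_le_of_le_one_right (abs_nonneg C) hynorm
  have hτs : RCLike.re (inner ℂ (τ (s * s) ξ) ξ) = ‖τ s ξ‖ ^ 2 := by
    have hsa : ContinuousLinearMap.adjoint (τ s) = τ s := by
      rw [← ContinuousLinearMap.star_eq_adjoint, ← map_star, hs.star_eq]
    rw [map_mul, mul_apply_eq_comp, ← hsa, ContinuousLinearMap.adjoint_inner_left, hsa,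
      inner_self_eq_norm_sq]
  rw [hτs, map_mul, hτ, mul_apply_eq_comp, ← sq_abs C, ← mul_pow]
  gcongr
  exact ContinuousLinearMap.le_of_opNorm_le _ hΦy _

variable [PartialOrder B] [StarOrderedRing B]

/- Write `x = y s` with `s = √b` and `y = x s⁻¹` a contraction. -/
lemma norm_map_apply_sq_le_of_isUnit (hΦ : ∀ x, ‖Φ x‖ ≤ C * ‖x‖) (hτ : ∀ b, Φ (j b) = τ b)
    {x : D} {b : B} (hb : 0 ≤ b) (hunit : IsUnit b) (hx : star x * x ≤ j b) (ξ : H) :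
    ‖Φ x ξ‖ ^ 2 ≤ C ^ 2 * RCLike.re (inner ℂ (τ b ξ) ξ) := by
  have hsb : CFC.sqrt b * CFC.sqrt b = b := CFC.sqrt_mul_sqrt_self b
  obtain ⟨s, hs⟩ := (CFC.isUnit_sqrt_iff b).2 hunit
  have hsa : IsSelfAdjoint (s : B) := hs ▸ (CFC.sqrt_nonneg b).isSelfAdjoint
  have hsinv : star (↑s⁻¹ : B) = ↑s⁻¹ := by
    rw [← Units.coe_star_inv, show star s = s from Units.ext hsa]
  have hy : star (x * j ↑s⁻¹) * (x * j ↑s⁻¹) ≤ 1 := calc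
    star (x * j ↑s⁻¹) * (x * j ↑s⁻¹) = star (j ↑s⁻¹) * (star x * x) * j ↑s⁻¹ := by
      simp only [star_mul, mul_assoc]
    _ ≤ star (j ↑s⁻¹) * j b * j ↑s⁻¹ := star_left_conjugate_le_conjugate hx _
    _ = 1 := by
      rw [← map_star, hsinv, ← map_mul, ← map_mul, ← hsb, ← hs]
      simp
  have hxs : x * j ↑s⁻¹ * j ↑s = x := by rw [mul_assoc, ← map_mul]; simp
  rw [← hsb, ← hs, ← hxs]
  exact norm_map_mul_apply_sq_le hΦ hτ hy hsa ξ

lemma norm_map_apply_sq_le (hΦ : ∀ x, ‖Φ x‖ ≤ C * ‖x‖) (hτ : ∀ b, Φ (j b) = τ b) {x : D} {b : B}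
    (hb : 0 ≤ b) (hx : star x * x ≤ j b) (ξ : H) :
    ‖Φ x ξ‖ ^ 2 ≤ C ^ 2 * RCLike.re (inner ℂ (τ b ξ) ξ) := by
  have hperturb (ε : ℝ) (hε : 0 < ε) :
      ‖Φ x ξ‖ ^ 2 ≤ C ^ 2 * (RCLike.re (inner ℂ (τ b ξ) ξ) + ε * ‖ξ‖ ^ 2) := by
    set u := b + algebraMap ℝ B ε with hu
    have hbu : b ≤ u := le_add_of_nonneg_right (algebraMap_nonneg B hε.le)
    have hunit : IsUnit u := CStarAlgebra.isUnit_of_le (algebraMap ℝ B ε)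
      (le_add_of_nonneg_left hb) (isStrictlyPositive_algebraMap hε)
    have hτu : RCLike.re (inner ℂ (τ u ξ) ξ) =
        RCLike.re (inner ℂ (τ b ξ) ξ) + ε * ‖ξ‖ ^ 2 := by
      rw [hu, Algebra.algebraMap_eq_smul_one, map_add, ← Complex.coe_smul, map_smul, map_one,
        add_apply, inner_add_left, map_add, smul_apply, one_apply_eq_self, inner_smul_left,
        Complex.conj_ofReal, ← Complex.real_smul, RCLike.smul_re, inner_self_eq_norm_sq]
    rw [← hτu]
    exact norm_map_apply_sq_le_of_isUnit hΦ hτ (hb.trans hbu) hunit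
      (hx.trans (OrderHomClass.mono j hbu)) ξ
  have hlim : Filter.Tendsto
      (fun ε : ℝ => C ^ 2 * (RCLike.re (inner ℂ (τ b ξ) ξ) + ε * ‖ξ‖ ^ 2))
      (nhdsWithin 0 (Set.Ioi 0)) (nhds (C ^ 2 * RCLike.re (inner ℂ (τ b ξ) ξ))) :=
    tendsto_nhdsWithin_of_tendsto_nhds (Continuous.tendsto' (by fun_prop) _ _ (by simp))
  exact ge_of_tendsto hlim (Filter.eventually_of_mem self_mem_nhdsWithin hperturb)

lemma sum_norm_map_apply_sq_le (hΦ : ∀ x, ‖Φ x‖ ≤ C * ‖x‖) (hτ : ∀ b, Φ (j b) = τ b)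
    (hrows : HasNormingRows τ) {κ : Type} [Fintype κ] {x : κ → D} {b : B} (hb : 0 ≤ b)
    (hx : ∑ k, star (x k) * x k ≤ j b) (ξ : H) :
    ∑ k, ‖Φ (x k) ξ‖ ^ 2 ≤ C ^ 2 * RCLike.re (inner ℂ (τ b ξ) ξ) := by
  set R := C ^ 2 * RCLike.re (inner ℂ (τ b ξ) ξ)
  have hsqrt : √(∑ k, ‖Φ (x k) ξ‖ ^ 2) ≤ √R := by
    refine le_of_forall_pos_le_add fun ε hε => ?_
    obtain ⟨c, hc, hnorm⟩ := hrows κ (fun k => Φ (x k) ξ) ε hε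
    have hjc : ‖∑ k, j (c k) * star (j (c k))‖ ≤ 1 := by
      simp only [← map_star, ← map_mul, ← map_sum]
      exact (NonUnitalStarAlgHom.norm_apply_le j _).trans hc
    have hrow := norm_map_apply_sq_le hΦ hτ hb ((star_sum_mul_mul_sum_mul_le hjc x).trans hx) ξ
    have hsum : Φ (∑ k, j (c k) * x k) ξ = ∑ k, τ (c k) (Φ (x k) ξ) := by
      simp [hτ, sum_apply]
    rw [hsum] at hrow
    exact hnorm.trans (by gcongr; exact Real.le_sqrt_of_sq_le hrow)
  have hR0 : 0 ≤ R := (sq_nonneg _).trans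
    (norm_map_apply_sq_le hΦ hτ (x := 0) hb (by simpa using map_nonneg j hb) ξ)
  exact (Real.sqrt_le_sqrt_iff hR0).1 hsqrt

end RowDomination

section Domination

lemma exists_linearMap_le_of_pointedCone {V : Type*} [AddCommGroup V] [Module ℝ V]
    (K : PointedCone ℝ (V × ℝ)) (hK : ∀ r, ((0 : V), r) ∈ K → 0 ≤ r)
    (hdom : ∀ v, ∃ r, (v, r) ∈ K) : ∃ f : V →ₗ[ℝ] ℝ, ∀ v r, (v, r) ∈ K → f v ≤ r := by
  let e : V × ℝ := (0, 1)
  have he : e ≠ 0 := by simp [e]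
  have hK' (x : (LinearPMap.mkSpanSingleton (σ := .id ℝ) e (1 : ℝ) he).domain)
      (hx : (x : V × ℝ) ∈ K) : 0 ≤ LinearPMap.mkSpanSingleton e (1 : ℝ) he x := by
    obtain ⟨x, hxe⟩ := x
    obtain ⟨t, rfl⟩ := Submodule.mem_span_singleton.1 hxe
    rw [LinearPMap.mkSpanSingleton'_apply]
    simpa using hK t (by simpa [e] using hx)
  obtain ⟨g, hg, hgK⟩ := riesz_extension K (LinearPMap.mkSpanSingleton e 1 he) hK' <| by
    rintro ⟨v, r⟩
    obtain ⟨t, ht⟩ := hdom v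
    exact ⟨⟨(t - r) • e, Submodule.smul_mem _ _ (Submodule.mem_span_singleton_self e)⟩,
      by simpa [e] using ht⟩
  have hge : g e = 1 :=
    (hg ⟨e, Submodule.mem_span_singleton_self e⟩).trans (LinearPMap.mkSpanSingleton_apply ..)
  refine ⟨-(g ∘ₗ LinearMap.inl ℝ V ℝ), fun v r hvr => ?_⟩
  have hsplit : (v, r) = LinearMap.inl ℝ V ℝ v + r • e := by simp [e]
  have hnonneg := hgK _ hvr
  rw [hsplit, map_add, map_smul, hge, smul_eq_mul, mul_one] at hnonneg
  rw [LinearMap.neg_apply, LinearMap.comp_apply]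
  linarith

end Domination

section Domination

open scoped ComplexOrder

variable {D : Type*} [CStarAlgebra D] [PartialOrder D] [StarOrderedRing D]
  {B : Type*} [CStarAlgebra B] [PartialOrder B] [StarOrderedRing B]
  {H : Type*} [NormedAddCommGroup H] [InnerProductSpace ℂ H] [CompleteSpace H]
  (Φ : D →ₐ[ℂ] (H →L[ℂ] H)) (j : B →⋆ₐ[ℂ] D) (τ : B →⋆ₐ[ℂ] (H →L[ℂ] H)) (C : ℝ) (ξ : H)

/-- The epigraph constraints on a functional `f` on the self-adjoint part of `D`: the pairs
`(d, r)` for which `f d ≤ r` is forced by `‖Φ x ξ‖² ≤ f (x* x)` for all `x` and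
`f (j b) ≤ C² ⟪τ b ξ, ξ⟫` for all `b ≥ 0`. -/
def dominationCone : PointedCone ℝ (selfAdjoint D × ℝ) where
  carrier := {p | ∃ (κ : Type) (_ : Fintype κ) (x : κ → D) (b : B), 0 ≤ b ∧
    p.1 + ∑ k, star (x k) * x k ≤ j b ∧
    C ^ 2 * RCLike.re (inner ℂ (τ b ξ) ξ) ≤ p.2 + ∑ k, ‖Φ (x k) ξ‖ ^ 2}
  zero_mem' := ⟨Empty, inferInstance, 0, 0, le_rfl, by simp, by simp⟩
  add_mem' := by
    rintro p p' ⟨κ, _, x, b, hb, hx, hr⟩ ⟨κ', _, x', b', hb', hx', hr'⟩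
    refine ⟨κ ⊕ κ', inferInstance, Sum.elim x x', b + b', add_nonneg hb hb', ?_, ?_⟩
    · simpa [add_add_add_comm] using add_le_add hx hx'
    · simpa [inner_add_left, mul_add, add_add_add_comm] using add_le_add hr hr'
  smul_mem' := by
    rintro ⟨t, ht⟩ ⟨d, r⟩ ⟨κ, _, x, b, hb, hx, hr⟩
    have htt : √t * √t = t := Real.mul_self_sqrt ht
    have hj : j ((t : ℂ) • b) = t • j b := by rw [map_smul, Complex.coe_smul]
    refine ⟨κ, inferInstance, fun k => (√t : ℂ) • x k, (t : ℂ) • b, ?_, ?_, ?_⟩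
    · rw [Complex.coe_smul]; exact smul_nonneg ht hb
    · rw [hj]
      convert smul_le_smul_of_nonneg_left hx ht using 1
      simp [smul_add, Finset.smul_sum, smul_smul, htt]
    · have hτ : RCLike.re (inner ℂ (τ ((t : ℂ) • b) ξ) ξ) =
          t * RCLike.re (inner ℂ (τ b ξ) ξ) := by
        rw [map_smul, smul_apply, inner_smul_left, Complex.conj_ofReal, ← Complex.real_smul,
          RCLike.smul_re]
      have hΦ (k : κ) : ‖Φ ((√t : ℂ) • x k) ξ‖ ^ 2 = t * ‖Φ (x k) ξ‖ ^ 2 := by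
        rw [map_smul, smul_apply, norm_smul, mul_pow, Complex.norm_real,
          Real.norm_of_nonneg (Real.sqrt_nonneg t), Real.sq_sqrt ht]
      simp only [hτ, hΦ, ← Finset.mul_sum]
      change C ^ 2 * (t * _) ≤ t * r + _
      linear_combination t * hr

variable {Φ j τ C ξ}

lemma nonneg_of_zero_mem_dominationCone (hΦ : ∀ x, ‖Φ x‖ ≤ C * ‖x‖) (hτ : ∀ b, Φ (j b) = τ b)
    (hrows : HasNormingRows τ) {r : ℝ} (hr : ((0 : selfAdjoint D), r) ∈ dominationCone Φ j τ C ξ) :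
    0 ≤ r := by
  obtain ⟨κ, _, x, b, hb, hx, hr⟩ := hr
  have := sum_norm_map_apply_sq_le hΦ hτ hrows hb (by simpa using hx) ξ
  simp only at hr
  linarith

lemma exists_mem_dominationCone (d : selfAdjoint D) : ∃ r, (d, r) ∈ dominationCone Φ j τ C ξ := by
  refine ⟨C ^ 2 * RCLike.re (inner ℂ (τ (algebraMap ℝ B ‖d‖) ξ) ξ), Empty, inferInstance, 0,
    algebraMap ℝ B ‖d‖, algebraMap_nonneg B (norm_nonneg d), ?_, by simp⟩
  have hj : j (algebraMap ℝ B ‖d‖) = algebraMap ℝ D ‖d‖ := by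
    simp [Algebra.algebraMap_eq_smul_one, ← Complex.coe_smul]
  rw [hj]
  simpa using d.2.le_algebraMap_norm_self

lemma exists_positiveLinearMap_re_eq (f : selfAdjoint D →ₗ[ℝ] ℝ)
    (hf : ∀ x : D, 0 ≤ f ⟨star x * x, .star_mul_self x⟩) :
    ∃ F : D →ₚ[ℂ] ℂ, ∀ d : selfAdjoint D, (F d).re = f d := by
  let F : D →ₗ[ℂ] ℂ := Module.Dual.extendRCLike (f ∘ₗ realPart)
  refine ⟨PositiveLinearMap.mk₀ F fun x hx => ?_, fun d => ?_⟩
  · have hx' : IsSelfAdjoint x := hx.isSelfAdjoint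
    obtain ⟨y, rfl⟩ := CStarAlgebra.nonneg_iff_eq_star_mul_self.1 hx
    rw [Complex.nonneg_iff]
    constructor
    · rw [← RCLike.re_eq_complex_re, Module.Dual.re_extendRCLike_apply]
      exact (hf y).trans_eq (congrArg f (Subtype.ext hx'.coe_realPart.symm))
    · rw [← RCLike.im_eq_complex_im, Module.Dual.im_extendRCLike_apply]
      simp [hx'.imaginaryPart]
  · refine (Module.Dual.re_extendRCLike_apply (𝕜 := ℂ) (f ∘ₗ realPart) (d : D)).trans ?_
    simp

lemma exists_positiveLinearMap_dominating (hΦ : ∀ x, ‖Φ x‖ ≤ C * ‖x‖) (hτ : ∀ b, Φ (j b) = τ b)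
    (hrows : HasNormingRows τ) (ξ : H) :
    ∃ f : D →ₚ[ℂ] ℂ, (∀ x, ‖Φ x ξ‖ ^ 2 ≤ (f (star x * x)).re) ∧
      ∀ b, (f (star (j b) * j b)).re ≤ C ^ 2 * ‖τ b ξ‖ ^ 2 := by
  obtain ⟨f, hf⟩ := exists_linearMap_le_of_pointedCone (dominationCone Φ j τ C ξ)
    (fun r hr => nonneg_of_zero_mem_dominationCone hΦ hτ hrows hr) exists_mem_dominationCone
  have hlower (x : D) : ‖Φ x ξ‖ ^ 2 ≤ f ⟨star x * x, .star_mul_self x⟩ := by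
    have := hf (-⟨star x * x, .star_mul_self x⟩) (-‖Φ x ξ‖ ^ 2)
      ⟨Unit, inferInstance, fun _ => x, 0, le_rfl, by simp, by simp⟩
    rw [map_neg] at this
    linarith
  have hupper (b : B) : f ⟨star (j b) * j b, .star_mul_self _⟩ ≤ C ^ 2 * ‖τ b ξ‖ ^ 2 := by
    refine hf _ _
      ⟨Empty, inferInstance, 0, star b * b, star_mul_self_nonneg b, by simp [map_star], ?_⟩
    rw [map_mul, map_star, mul_apply_eq_comp, ContinuousLinearMap.star_eq_adjoint,
      ContinuousLinearMap.adjoint_inner_left, inner_self_eq_norm_sq]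
    simp
  obtain ⟨F, hF⟩ := exists_positiveLinearMap_re_eq f fun x => (sq_nonneg _).trans (hlower x)
  exact ⟨F, fun x => (hlower x).trans_eq (hF _).symm, fun b => (hF _).trans_le (hupper b)⟩

end Domination

section Intertwiner

open scoped ComplexOrder

variable {D : Type*} [CStarAlgebra D] [PartialOrder D] [StarOrderedRing D]
  {H : Type*} [NormedAddCommGroup H] [InnerProductSpace ℂ H] [CompleteSpace H]
  {Φ : D →ₐ[ℂ] (H →L[ℂ] H)}

lemma exists_gns_intertwiner (f : D →ₚ[ℂ] ℂ) {ξ : H} (hf : ∀ x, ‖Φ x ξ‖ ^ 2 ≤ (f (star x * x)).re) :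
    ∃ S : f.GNS →L[ℂ] H, (∀ x, S (f.toPreGNS x) = Φ x ξ) ∧
      ∀ x, Φ x ∘L S = S ∘L f.gnsStarAlgHom x := by
  let S₀ : f.PreGNS →L[ℂ] H := LinearMap.mkContinuous
    (LinearMap.applyₗ ξ ∘ₗ ContinuousLinearMap.coeLM ℂ ∘ₗ Φ.toLinearMap ∘ₗ f.ofPreGNS.toLinearMap) 1
    fun x => by
      rw [one_mul, f.preGNS_norm_def]
      exact Real.le_sqrt_of_sq_le (hf _)
  let S : f.GNS →L[ℂ] H := S₀.extend (UniformSpace.Completion.toComplL (𝕜 := ℂ))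
  have hS (x : D) : S (f.toPreGNS x) = Φ x ξ :=
    S₀.extend_eq UniformSpace.Completion.denseRange_coe
      (UniformSpace.Completion.isUniformInducing_coe f.PreGNS) (f.toPreGNS x)
  refine ⟨S, hS, fun x => ContinuousLinearMap.ext fun y => ?_⟩
  induction y using UniformSpace.Completion.induction_on with
  | hp => apply isClosed_eq <;> fun_prop
  | ih y =>
    obtain ⟨y, rfl⟩ := f.toPreGNS.surjective y
    simp [hS]

theorem exists_isSelfAdjoint_star_map_mul {B : Type*} [CStarAlgebra B] {j : B →⋆ₐ[ℂ] D}
    {τ : B →⋆ₐ[ℂ] (H →L[ℂ] H)} {C : ℝ} (hΦ : ∀ x, ‖Φ x‖ ≤ C * ‖x‖) (hτ : ∀ b, Φ (j b) = τ b)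
    (hrows : HasNormingRows τ) {ξ : H} (hξ : DenseRange fun b => τ b ξ) :
    ∃ q : H →L[ℂ] H, IsSelfAdjoint q ∧ (∀ x, star (Φ x * q) = Φ (star x) * q) ∧
      ∀ g, ‖g‖ ^ 2 ≤ C ^ 2 * RCLike.re (inner ℂ (q g) g) := by
  let _ := CStarAlgebra.spectralOrder B
  have := CStarAlgebra.spectralOrderedRing B
  obtain ⟨f, hlower, hupper⟩ := exists_positiveLinearMap_dominating hΦ hτ hrows ξ
  obtain ⟨S, hS, hΦS⟩ := exists_gns_intertwiner f hlower
  refine ⟨S ∘L S.adjoint, ?_, fun x => ?_, fun g => ?_⟩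
  · simp [IsSelfAdjoint, ContinuousLinearMap.star_eq_adjoint, ContinuousLinearMap.adjoint_comp]
  · have hcomp (x : D) : Φ x * (S ∘L S.adjoint) = S ∘L f.gnsStarAlgHom x ∘L S.adjoint := by
      rw [← ContinuousLinearMap.comp_assoc, ← hΦS]; rfl
    rw [hcomp, hcomp, map_star]
    simp only [ContinuousLinearMap.star_eq_adjoint, ContinuousLinearMap.adjoint_comp,
      ContinuousLinearMap.adjoint_adjoint, ContinuousLinearMap.comp_assoc]
  · have hbound (h : H) : ‖inner ℂ h g‖ ≤ |C| * ‖h‖ * ‖S.adjoint g‖ := by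
      refine hξ.induction_on (p := fun h => ‖inner ℂ h g‖ ≤ |C| * ‖h‖ * ‖S.adjoint g‖) h
        (isClosed_le (by fun_prop) (by fun_prop)) fun b => ?_
      rw [← hτ, ← hS, ← ContinuousLinearMap.adjoint_inner_right]
      refine (norm_inner_le_norm _ _).trans ?_
      gcongr
      rw [UniformSpace.Completion.norm_coe, f.preGNS_norm_def, hS, hτ]
      refine Real.sqrt_le_iff.2 ⟨by positivity, ?_⟩
      rw [mul_pow, sq_abs]
      exact hupper b
    have hle : ‖g‖ ≤ |C| * ‖S.adjoint g‖ := by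
      by_contra! hlt
      have := hbound g
      simp only [inner_self_eq_norm_sq_to_K, norm_pow, RCLike.norm_ofReal, abs_norm] at this
      have hg : 0 < ‖g‖ := (by positivity : 0 ≤ |C| * ‖S.adjoint g‖).trans_lt hlt
      nlinarith
    calc ‖g‖ ^ 2 ≤ (|C| * ‖S.adjoint g‖) ^ 2 := by gcongr
      _ = C ^ 2 * RCLike.re (inner ℂ ((S ∘L S.adjoint) g) g) := by
        rw [mul_pow, sq_abs, ContinuousLinearMap.comp_apply,
          ← ContinuousLinearMap.adjoint_inner_right, inner_self_eq_norm_sq]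

end Intertwiner

/-! ### Bounded representations of the maximal tensor product -/

namespace MaxTensor

variable {A : Type u} {B : Type v} [NonUnitalCStarAlgebra A] [NonUnitalCStarAlgebra B]

/-- Evaluation of the maximal tensor product at a commuting pair `(σ, τ)`: the ⋆-representation
`a ⊗ b ↦ σ(a) τ(b)`. -/
def eval (p : CommutingPair A B) : MaxTensor A B →⋆ₙₐ[ℂ] (p.space →L[ℂ] p.space) where
  toFun x := x.1 p
  map_smul' _ _ := rfl
  map_zero' := rfl
  map_add' _ _ := rfl
  map_mul' _ _ := rfl
  map_star' _ := rfl

lemma eval_maxTmul (p : CommutingPair A B) (a : A) (b : B) :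
    eval p (maxTmul a b) = p.left a * p.right b := rfl

lemma ext_eval {x y : MaxTensor A B} (h : ∀ p, eval p x = eval p y) : x = y :=
  Subtype.ext (lp.ext (funext h))

lemma maxTmul_mul_maxTmul (a a' : A) (b b' : B) :
    maxTmul a b * maxTmul a' b' = maxTmul (a * a') (b * b') :=
  ext_eval fun p => by
    simp only [map_mul, eval_maxTmul]
    rw [mul_assoc, ← mul_assoc (p.right b), ← (p.commute a' b).eq]
    simp only [mul_assoc]

lemma star_maxTmul (a : A) (b : B) : star (maxTmul a b) = maxTmul (star a) (star b) :=
  ext_eval fun p => by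
    simp only [map_star, eval_maxTmul, star_mul]
    rw [← map_star, ← map_star, (p.commute _ _).eq]

lemma dense_span_maxTmul :
    Dense (Submodule.span ℂ (Set.range fun x : A × B => maxTmul x.1 x.2) :
      Set (MaxTensor A B)) := by
  set s : Set (UniversalPairProduct A B) := Set.range fun x : A × B => universalTmul x.1 x.2
  have hmul {x y} (hx : x ∈ s) (hy : y ∈ s) : x * y ∈ s := by
    obtain ⟨⟨a, b⟩, rfl⟩ := hx
    obtain ⟨⟨a', b'⟩, rfl⟩ := hy
    exact ⟨(a * a', b * b'), congr(Subtype.val $(maxTmul_mul_maxTmul a a' b b')).symm⟩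
  have hstar : star s ⊆ s := by
    rintro x ⟨⟨a, b⟩, hab⟩
    exact ⟨(star a, star b), congr(Subtype.val $(star_maxTmul a b)).symm.trans
      (star_eq_iff_star_eq.1 hab.symm)⟩
  let S : Subsemigroup (UniversalPairProduct A B) := ⟨s, hmul⟩
  have hspan : (NonUnitalStarAlgebra.adjoin ℂ s).toSubmodule = Submodule.span ℂ s := by
    rw [NonUnitalStarAlgebra.adjoin_eq_span, Set.union_eq_left.2 hstar,
      show Subsemigroup.closure s = S from S.closure_eq]
    rfl
  intro x
  refine (closure_subtype (p := (· ∈ maxTensorSubalgebra A B))).2 ?_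
  let val : MaxTensor A B →ₗ[ℂ] UniversalPairProduct A B :=
    { toFun := Subtype.val, map_add' := fun _ _ => rfl, map_smul' := fun _ _ => rfl }
  have himage : Subtype.val '' (Submodule.span ℂ (Set.range fun x : A × B => maxTmul x.1 x.2) :
      Set (MaxTensor A B)) = NonUnitalStarAlgebra.adjoin ℂ s := by
    refine (Submodule.map_coe val _).symm.trans ?_
    rw [Submodule.map_span, ← Set.range_comp]
    exact congr(($hspan : Set (UniversalPairProduct A B))).symm
  rw [himage]
  exact x.2

end MaxTensor

lemma IsBoundedRep.apply_eq_self_of_maxTmul {A : Type u} {B : Type v} [NonUnitalCStarAlgebra A]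
    [NonUnitalCStarAlgebra B] {H : Type*} [NormedAddCommGroup H] [InnerProductSpace ℂ H]
    {Φ : MaxTensor A B →ₙₐ[ℂ] (H →L[ℂ] H)} (hΦ : IsBoundedRep Φ)
    {L : (H →L[ℂ] H) →L[ℂ] (H →L[ℂ] H)}
    (h : ∀ a b, L (Φ (maxTmul a b)) = Φ (maxTmul a b)) (x : MaxTensor A B) : L (Φ x) = Φ x := by
  obtain ⟨C, hC⟩ := hΦ
  let Ψ : MaxTensor A B →L[ℂ] (H →L[ℂ] H) := LinearMap.mkContinuous Φ C hC
  have : L ∘L Ψ = Ψ := ContinuousLinearMap.ext_on MaxTensor.dense_span_maxTmul <| by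
    rintro _ ⟨⟨a, b⟩, rfl⟩
    exact h a b
  exact congr($this x)

section CommutingRange

variable {D : Type*} [NonUnitalCStarAlgebra D] {B : Type*} [NonUnitalCStarAlgebra B]
  {H : Type*} [NormedAddCommGroup H] [InnerProductSpace ℂ H] [CompleteSpace H]

/-- The homomorphism `(x, b) ↦ Φ x + (1 - p) τ(b)`, for a homomorphism `Φ` into the corner of an
idempotent `p` and a representation `τ` commuting with `p`. -/
def addComplement (Φ : D →ₙₐ[ℂ] (H →L[ℂ] H))
    (τ : B →⋆ₙₐ[ℂ] (H →L[ℂ] H)) (p : H →L[ℂ] H) (hp : IsIdempotentElem p)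
    (hpΦ : ∀ x, p * Φ x = Φ x) (hΦp : ∀ x, Φ x * p = Φ x) (hpτ : ∀ b, Commute p (τ b)) :
    D × B →ₙₐ[ℂ] (H →L[ℂ] H) where
  toFun x := Φ x.1 + (1 - p) * τ x.2
  map_smul' c x := by simp
  map_zero' := by simp
  map_add' x y := by simp only [Prod.fst_add, Prod.snd_add, map_add, mul_add]; abel
  map_mul' x y := by
    have hleft : (1 - p) * τ x.2 * Φ y.1 = 0 := by
      rw [((Commute.one_left _).sub_left (hpτ x.2)).eq, mul_assoc, sub_mul, hpΦ, one_mul, sub_self,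
        mul_zero]
    have hright : Φ x.1 * ((1 - p) * τ y.2) = 0 := by
      rw [← mul_assoc, mul_sub, hΦp, mul_one, sub_self, zero_mul]
    have hdiag : (1 - p) * τ x.2 * ((1 - p) * τ y.2) = (1 - p) * (τ x.2 * τ y.2) := by
      rw [← mul_assoc, mul_assoc _ (τ x.2), ← ((Commute.one_left _).sub_left (hpτ x.2)).eq,
        ← mul_assoc, hp.one_sub.eq, mul_assoc]
    simp only [Prod.fst_mul, Prod.snd_mul, map_mul, add_mul, mul_add, hleft, hright, hdiag,
      zero_add, add_zero]

lemma isBoundedRep_addComplement {Φ : D →ₙₐ[ℂ] (H →L[ℂ] H)} (hΦ : IsBoundedRep Φ)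
    {τ : B →⋆ₙₐ[ℂ] (H →L[ℂ] H)} {p : H →L[ℂ] H} (hp : IsIdempotentElem p)
    (hpΦ : ∀ x, p * Φ x = Φ x) (hΦp : ∀ x, Φ x * p = Φ x) (hpτ : ∀ b, Commute p (τ b)) :
    IsBoundedRep (addComplement Φ τ p hp hpΦ hΦp hpτ) := by
  obtain ⟨C, hC⟩ := hΦ
  refine ⟨|C| + ‖1 - p‖, fun x => ?_⟩
  calc ‖Φ x.1 + (1 - p) * τ x.2‖ ≤ ‖Φ x.1‖ + ‖1 - p‖ * ‖τ x.2‖ :=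
        (norm_add_le _ _).trans (by gcongr; exact norm_mul_le _ _)
    _ ≤ |C| * ‖x‖ + ‖1 - p‖ * ‖x‖ := by
        gcongr
        · exact (hC _).trans (by gcongr; exacts [le_abs_self C, norm_fst_le x])
        · exact (NonUnitalStarAlgHom.norm_apply_le τ _).trans (norm_snd_le x)
    _ = (|C| + ‖1 - p‖) * ‖x‖ := by ring

lemma star_map_mul_eq_of_commute {ψ : D →ₙₐ[ℂ] (H →L[ℂ] H)} {τ : B →⋆ₙₐ[ℂ] (H →L[ℂ] H)}
    {q : H →L[ℂ] H} (hcomm : ∀ a b, Commute (ψ a) (τ b)) (hq : ∀ b, Commute (τ b) q)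
    (h : ∀ a b, star (ψ a * τ b * q) = ψ (star a) * τ (star b) * q)
    {ξ : H} (hξ : DenseRange fun b => τ b ξ) (a : D) :
    star (ψ a * q) = ψ (star a) * q := by
  have hmul (b : B) : star (ψ a * q) * τ b = ψ (star a) * q * τ b := by
    have hb := h a (star b)
    rwa [star_star, (hcomm _ _).eq, mul_assoc, star_mul, ← map_star, star_star, mul_assoc (ψ _),
      (hq b).eq, ← mul_assoc (ψ _)] at hb
  refine ContinuousLinearMap.ext fun x => ?_
  exact congr_fun (hξ.equalizer (star (ψ a * q)).continuous (ψ (star a) * q).continuous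
    (funext fun b => congr($(hmul b) ξ))) x

lemma exists_norm_toAlgHom_le {Φ : D →ₙₐ[ℂ] (H →L[ℂ] H)} (hΦ : IsBoundedRep Φ) :
    ∃ C : ℝ, ∀ x, ‖Φ.toAlgHom x‖ ≤ C * ‖x‖ := by
  obtain ⟨C, hC⟩ := hΦ
  refine ⟨2 * (1 + |C|), fun x => ?_⟩
  have hx : ‖Unitization.addEquiv ℂ D x‖ ≤ 2 * ‖x‖ := by
    simpa using Unitization.lipschitzWith_addEquiv.norm_le_mul (map_zero _) x
  calc ‖Φ.toAlgHom x‖ ≤ ‖algebraMap ℂ (H →L[ℂ] H) x.fst‖ + ‖Φ x.snd‖ := by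
        rw [NonUnitalAlgHom.toAlgHom_apply]
        exact norm_add_le _ _
    _ ≤ ‖x.fst‖ + |C| * ‖x.snd‖ := by
        gcongr
        · rw [Algebra.algebraMap_eq_smul_one, norm_smul]
          exact mul_le_of_le_one_right (norm_nonneg _) ContinuousLinearMap.norm_id_le
        · exact (hC _).trans (by gcongr; exact le_abs_self C)
    _ ≤ 2 * ‖x‖ + |C| * (2 * ‖x‖) := by
        gcongr
        · exact (norm_fst_le _).trans hx
        · exact (norm_snd_le _).trans hx
    _ = 2 * (1 + |C|) * ‖x‖ := by ring

theorem exists_isSelfAdjoint_star_map_mul_of_nonUnital {Φ : D →ₙₐ[ℂ] (H →L[ℂ] H)}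
    (hΦ : IsBoundedRep Φ) {j : B →⋆ₙₐ[ℂ] D} {τ : B →⋆ₙₐ[ℂ] (H →L[ℂ] H)}
    (hτ : ∀ b, Φ (j b) = τ b) (hrows : HasNormingRows τ) {ξ : H}
    (hξ : DenseRange fun b => τ b ξ) :
    ∃ q : H →L[ℂ] H, IsSelfAdjoint q ∧ (∀ x, star (Φ x * q) = Φ (star x) * q) ∧
      ∃ κ > 0, ∀ g, κ * ‖g‖ ^ 2 ≤ RCLike.re (inner ℂ (q g) g) := by
  let _ := CStarAlgebra.spectralOrder (Unitization ℂ D)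
  have := CStarAlgebra.spectralOrderedRing (Unitization ℂ D)
  obtain ⟨C, hC⟩ := exists_norm_toAlgHom_le hΦ
  have hC' (x : Unitization ℂ D) : ‖Φ.toAlgHom x‖ ≤ max C 1 * ‖x‖ :=
    (hC x).trans (by gcongr; exact le_max_left _ _)
  have hlift (b : B) : Unitization.starLift τ b = τ b :=
    DFunLike.congr_fun (Unitization.starLift.symm_apply_apply τ) b
  have hτ' (b : Unitization ℂ B) :
      Φ.toAlgHom (Unitization.starMap j b) = Unitization.starLift τ b := by
    have hτ_fst : (Unitization.starMap j b).fst = b.fst := by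
      simp [Unitization.algebraMap_eq_inl]
    have hτ_snd : (Unitization.starMap j b).snd = j b.snd := by
      simp [Unitization.algebraMap_eq_inl]
    rw [NonUnitalAlgHom.toAlgHom_apply, hτ_fst, hτ_snd, hτ]
    rfl
  have hrows' : HasNormingRows (Unitization.starLift τ) := fun ι _ η ε hε => by
    obtain ⟨c, hc, hη⟩ := hrows ι η ε hε
    refine ⟨fun k => c k, ?_, by simpa only [hlift] using hη⟩
    have : ∑ k, (c k : Unitization ℂ B) * star (c k : Unitization ℂ B) =
        ((∑ k, c k * star (c k) : B) : Unitization ℂ B) := by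
      simp only [← Unitization.inr_star, ← Unitization.inr_mul]
      exact (map_sum (Unitization.inrNonUnitalStarAlgHom ℂ B) (fun k => c k * star (c k)) _).symm
    rwa [this, Unitization.norm_inr]
  have hξ' : DenseRange fun b => Unitization.starLift τ b ξ :=
    hξ.mono (by rintro _ ⟨b, rfl⟩; exact ⟨b, by simp only [hlift]⟩)
  obtain ⟨q, hq, hstar, hlower⟩ := exists_isSelfAdjoint_star_map_mul hC' hτ' hrows' hξ'
  refine ⟨q, hq, fun x => by simpa using hstar x, ((max C 1) ^ 2)⁻¹, by positivity, fun g => ?_⟩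
  rw [inv_mul_le_iff₀ (by positivity)]
  exact hlower g

end CommutingRange

section CommutingPair

variable {A : Type u} [CStarAlgebra A] {B : Type v} [NonUnitalCStarAlgebra B]
  {H : Type*} [NormedAddCommGroup H] [InnerProductSpace ℂ H] [CompleteSpace H]

variable (A B) in
/-- The ⋆-homomorphism `b ↦ 1 ⊗ b` from `B` to `A ⊗_max B`. -/
def MaxTensor.includeRight : B →⋆ₙₐ[ℂ] MaxTensor A B where
  toFun b := maxTmul 1 b
  map_smul' c b := MaxTensor.ext_eval fun p => by simp [MaxTensor.eval_maxTmul]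
  map_zero' := MaxTensor.ext_eval fun p => by simp [MaxTensor.eval_maxTmul]
  map_add' b b' := MaxTensor.ext_eval fun p => by simp [MaxTensor.eval_maxTmul, mul_add]
  map_mul' b b' := by rw [MaxTensor.maxTmul_mul_maxTmul, one_mul]
  map_star' b := by rw [MaxTensor.star_maxTmul, star_one]

lemma MaxTensor.includeRight_apply (b : B) : MaxTensor.includeRight A B b = maxTmul 1 b := rfl

/- `Φ` need not be unital on the first leg: it lives in the corner of `p = ψ 1`, and adding the
compression of `τ` to the complementary corner turns it into a homomorphism that extends `τ`. -/
theorem exists_isSelfAdjoint_star_map_mul_of_maxTensor {ψ : A →ₙₐ[ℂ] (H →L[ℂ] H)}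
    {τ : B →⋆ₙₐ[ℂ] (H →L[ℂ] H)} (hcomm : ∀ a b, Commute (ψ a) (τ b))
    {Φ : MaxTensor A B →ₙₐ[ℂ] (H →L[ℂ] H)} (hΦ : IsBoundedRep Φ)
    (hΦψ : ∀ a b, Φ (maxTmul a b) = ψ a * τ b) (hrows : HasNormingRows τ) {ξ : H}
    (hξ : DenseRange fun b => τ b ξ) :
    ∃ q : H →L[ℂ] H, IsSelfAdjoint q ∧ (∀ b, Commute (τ b) q) ∧
      (∀ a, star (ψ a * q) = ψ (star a) * q) ∧
      ∃ κ > 0, ∀ g, κ * ‖g‖ ^ 2 ≤ RCLike.re (inner ℂ (q g) g) := by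
  have hp : IsIdempotentElem (ψ 1) := by rw [IsIdempotentElem, ← map_mul, one_mul]
  have hpΦ : ∀ x, ψ 1 * Φ x = Φ x :=
    hΦ.apply_eq_self_of_maxTmul (L := ContinuousLinearMap.mul ℂ _ (ψ 1)) fun a b => by
      rw [ContinuousLinearMap.mul_apply', hΦψ, ← mul_assoc, ← map_mul, one_mul]
  have hΦp : ∀ x, Φ x * ψ 1 = Φ x :=
    hΦ.apply_eq_self_of_maxTmul (L := (ContinuousLinearMap.mul ℂ _).flip (ψ 1)) fun a b => by
      rw [ContinuousLinearMap.flip_apply, ContinuousLinearMap.mul_apply', hΦψ, mul_assoc,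
        ← (hcomm 1 b).eq, ← mul_assoc, ← map_mul, mul_one]
  set Φ' := addComplement Φ τ (ψ 1) hp hpΦ hΦp (hcomm 1) with hΦ'_def
  have hΦ'_apply (x) : Φ' x = Φ x.1 + (1 - ψ 1) * τ x.2 := rfl
  have hΦ'τ (b : B) :
      Φ' ((MaxTensor.includeRight A B).prod (NonUnitalStarAlgHom.id ℂ B) b) = τ b := by
    simp only [hΦ'_apply, NonUnitalStarAlgHom.prod_apply, MaxTensor.includeRight_apply, hΦψ,
      sub_mul, one_mul]
    exact add_sub_cancel _ _
  obtain ⟨q, hq, hstar, hlower⟩ := exists_isSelfAdjoint_star_map_mul_of_nonUnital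
    (isBoundedRep_addComplement hΦ hp hpΦ hΦp (hcomm 1)) hΦ'τ hrows hξ
  have hqτ (b : B) : Commute (τ b) q := by
    have := hstar ((MaxTensor.includeRight A B).prod (NonUnitalStarAlgHom.id ℂ B) (star b))
    rwa [← map_star, star_star, ← hΦ'_def, hΦ'τ, hΦ'τ, star_mul, hq.star_eq, ← map_star,
      star_star, eq_comm] at this
  refine ⟨q, hq, hqτ, star_map_mul_eq_of_commute hcomm hqτ (fun a b => ?_) hξ, hlower⟩
  simpa [← hΦ'_def, hΦ'_apply, MaxTensor.star_maxTmul, hΦψ] using hstar (maxTmul a b, 0)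

end CommutingPair

/-! ### Similarity -/

section WeakDensity

variable {H : Type*} [NormedAddCommGroup H] [InnerProductSpace ℂ H] [CompleteSpace H]
  {M : VonNeumannAlgebra H}

lemma IsWeaklyDenseIn.mem_of_forall_commute {B : Set (H →L[ℂ] H)}
    (hB : IsWeaklyDenseIn B (M.commutant : Set (H →L[ℂ] H))) {q : H →L[ℂ] H}
    (hq : ∀ b ∈ B, Commute b q) : q ∈ M := by
  rw [← M.commutant_commutant, VonNeumannAlgebra.mem_commutant_iff]
  intro y hy
  ext h
  refine sub_eq_zero.1 (ext_inner_left ℂ fun g => ?_)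
  let F : (H →WOT[ℂ] H) → ℝ := fun T =>
    ‖InnerProductSpace.toDual ℂ H g (T (q h)) - InnerProductSpace.toDual ℂ H (star q g) (T h)‖
  have hF : Continuous F :=
    ((ContinuousLinearMapWOT.continuous_dual_apply _ _).sub
      (ContinuousLinearMapWOT.continuous_dual_apply _ _)).norm
  have hF_apply (T : H →L[ℂ] H) :
      F (ContinuousLinearMapWOT.ofCLM T) = ‖inner ℂ g ((T * q) h - (q * T) h)‖ := by
    simp [F, ContinuousLinearMap.star_eq_adjoint,
      ContinuousLinearMap.adjoint_inner_left]
  have hF_le := hB.le_of_forall_le hF (r := 0)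
    (fun b hb => by rw [hF_apply, (hq b hb).eq, sub_self, inner_zero_right, norm_zero]) hy
  rw [hF_apply] at hF_le
  rw [inner_zero_right]
  exact norm_le_zero_iff.1 hF_le

lemma commute_starProjection_of_mem_invtSubmodule {V : Submodule ℂ H} [V.HasOrthogonalProjection]
    {b : H →L[ℂ] H} (hb : V ∈ Module.End.invtSubmodule b.toLinearMap)
    (hb' : V ∈ Module.End.invtSubmodule (star b).toLinearMap) : Commute b V.starProjection := by
  refine Commute.symm ?_
  rw [ContinuousLinearMap.IsIdempotentElem.commute_iff V.isIdempotentElem_starProjection,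
    V.range_starProjection, V.ker_starProjection]
  exact ⟨hb, ContinuousLinearMap.orthogonal_mem_invtSubmodule hb'⟩

lemma IsWeaklyDenseIn.denseRange_apply {B : NonUnitalStarSubalgebra ℂ (H →L[ℂ] H)}
    (hB : IsWeaklyDenseIn (B : Set (H →L[ℂ] H)) (M.commutant : Set (H →L[ℂ] H))) {ξ : H}
    (hξ : IsSeparatingVector (M : Set (H →L[ℂ] H)) ξ) :
    DenseRange fun b : B => (b : H →L[ℂ] H) ξ := by
  let L : Submodule ℂ H := B.toSubmodule.map (ContinuousLinearMap.apply ℂ H ξ).toLinearMap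
  have hL : (L : Set H) = Set.range fun b : B => (b : H →L[ℂ] H) ξ := by
    rw [Set.range_comp' (fun b : H →L[ℂ] H => b ξ) Subtype.val, Subtype.range_coe]
    rfl
  set V := L.topologicalClosure
  have hinv : ∀ b ∈ B, V ∈ Module.End.invtSubmodule b.toLinearMap := fun b hb => by
    refine L.topologicalClosure_minimal ?_
      (L.isClosed_topologicalClosure.preimage b.continuous)
    rintro _ ⟨c, hc, rfl⟩
    exact L.le_topologicalClosure ⟨b * c, B.mul_mem hb hc, rfl⟩
  have : CompleteSpace V := L.isClosed_topologicalClosure.completeSpace_coe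
  have hP : V.starProjection ∈ M := hB.mem_of_forall_commute fun b hb =>
    commute_starProjection_of_mem_invtSubmodule (hinv b hb) (hinv _ (star_mem hb))
  have hξV : ξ ∈ V := Metric.mem_closure_iff.2 fun ε hε => by
    obtain ⟨b, hb, hbξ, -⟩ := hB.exists_norm_sub_lt (one_mem M.commutant) ξ 0 hε
    exact ⟨b ξ, ⟨b, hb, rfl⟩, by rwa [dist_eq_norm]⟩
  have hP_eq : 1 - V.starProjection = 0 := hξ _ (sub_mem (one_mem M) hP) <| by
    rw [_root_.sub_apply, Submodule.starProjection_eq_self_iff.2 hξV, one_apply_eq_self, sub_self]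
  rw [DenseRange, ← hL]
  intro x
  exact Submodule.starProjection_eq_self_iff.1 congr($(sub_eq_zero.1 hP_eq) x).symm

end WeakDensity

section Similarity

variable {A : Type u} [NonUnitalCStarAlgebra A]
  {H : Type v} [NormedAddCommGroup H] [InnerProductSpace ℂ H] [CompleteSpace H]

/-- The conjugate `x ↦ s⁻¹ Φ(x) s` of a homomorphism by an invertible element. -/
def conjRep {X Y : Type*} [NonUnitalNonAssocSemiring X] [Module ℂ X] [Ring Y] [Algebra ℂ Y]
    (Φ : X →ₙₐ[ℂ] Y) (s : Yˣ) : X →ₙₐ[ℂ] Y where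
  toFun x := ↑s⁻¹ * Φ x * s
  map_smul' c x := by simp
  map_zero' := by simp
  map_add' x y := by simp [mul_add, add_mul]
  map_mul' x y := by simp [mul_assoc]

lemma conjRep_apply {X Y : Type*} [NonUnitalNonAssocSemiring X] [Module ℂ X] [Ring Y] [Algebra ℂ Y]
    (Φ : X →ₙₐ[ℂ] Y) (s : Yˣ) (x : X) : conjRep Φ s x = ↑s⁻¹ * Φ x * s := rfl

lemma IsBoundedRep.conjRep {Φ : A →ₙₐ[ℂ] (H →L[ℂ] H)} (hΦ : IsBoundedRep Φ)
    (s : (H →L[ℂ] H)ˣ) : IsBoundedRep (conjRep Φ s) := by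
  obtain ⟨C, hC⟩ := hΦ
  refine ⟨‖(↑s⁻¹ : H →L[ℂ] H)‖ * C * ‖(s : H →L[ℂ] H)‖, fun a => ?_⟩
  calc ‖↑s⁻¹ * Φ a * ↑s‖ ≤ ‖(↑s⁻¹ : H →L[ℂ] H)‖ * ‖Φ a‖ * ‖(s : H →L[ℂ] H)‖ := norm_mul₃_le
    _ ≤ ‖(↑s⁻¹ : H →L[ℂ] H)‖ * (C * ‖a‖) * ‖(s : H →L[ℂ] H)‖ := by gcongr; exact hC a
    _ = _ := by ring

/- Conjugation by the square root of `q`. -/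
lemma isSimilarToStarRep_of_intertwining {φ : A →ₙₐ[ℂ] (H →L[ℂ] H)} {q : H →L[ℂ] H} (hq : 0 ≤ q)
    (hu : IsUnit q) (h : ∀ a, star (φ a * q) = φ (star a) * q) : IsSimilarToStarRep φ := by
  obtain ⟨r, hr⟩ := (CFC.isUnit_sqrt_iff q hq).2 hu
  have hrr : (r : H →L[ℂ] H) * r = q := by rw [hr]; exact CFC.sqrt_mul_sqrt_self q hq
  have hstar : star r = r := Units.ext <| by
    rw [Units.coe_star, hr, (CFC.sqrt_nonneg q).isSelfAdjoint.star_eq]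
  have hmap_star (a : A) : conjRep φ r (star a) = star (conjRep φ r a) := by
    have hq_star : φ (star a) * ↑r * ↑r = ↑r * ↑r * star (φ a) := by
      rw [mul_assoc, hrr, ← h, star_mul, ← hrr, star_mul, ← Units.coe_star, hstar]
    simp only [conjRep_apply, star_mul, ← Units.coe_star, star_inv, hstar]
    rw [mul_assoc, Units.inv_mul_eq_iff_eq_mul, ← mul_assoc, ← mul_assoc,
      Units.eq_mul_inv_iff_mul_eq, hq_star]
  exact ⟨r⁻¹, { conjRep φ r with map_star' := hmap_star }, fun a => by rw [inv_inv]; rfl⟩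

lemma algebraMap_le_of_mul_norm_sq_le {q : H →L[ℂ] H} (hq : IsSelfAdjoint q) {κ : ℝ}
    (hκ : ∀ g, κ * ‖g‖ ^ 2 ≤ RCLike.re (inner ℂ (q g) g)) : algebraMap ℝ _ κ ≤ q := by
  rw [ContinuousLinearMap.le_def, ContinuousLinearMap.isPositive_def']
  refine ⟨hq.sub (.algebraMap _ (.all κ)), fun x => ?_⟩
  have hscalar : (algebraMap ℝ (H →L[ℂ] H) κ) x = (κ : ℂ) • x := by
    simp [Algebra.algebraMap_eq_smul_one]
  rw [ContinuousLinearMap.reApplyInnerSelf_apply, _root_.sub_apply, hscalar, inner_sub_left,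
    inner_smul_left, map_sub, sub_nonneg]
  refine le_trans (le_of_eq ?_) (hκ x)
  rw [← inner_self_eq_norm_sq (𝕜 := ℂ)]
  simp

/- The spectrum of `q` can be read off in the faithful representation `ρ`. -/
lemma isSimilarToStarRep_of_faithful {K : Type*} [NormedAddCommGroup K]
    [InnerProductSpace ℂ K] [CompleteSpace K] (ρ : (K →L[ℂ] K) →⋆ₐ[ℂ] (H →L[ℂ] H))
    (hρ : Function.Injective ρ) {φ : A →ₙₐ[ℂ] (K →L[ℂ] K)} {q : K →L[ℂ] K}
    (hq : IsSelfAdjoint (ρ q)) {κ : ℝ} (hκ : 0 < κ)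
    (hqκ : ∀ g, κ * ‖g‖ ^ 2 ≤ RCLike.re (inner ℂ (ρ q g) g))
    (h : ∀ a, star (ρ (φ a) * ρ q) = ρ (φ (star a)) * ρ q) : IsSimilarToStarRep φ := by
  have hq_sa : IsSelfAdjoint q := hρ (by rw [map_star, hq.star_eq])
  have hspec : ∀ t ∈ spectrum ℝ q, κ ≤ t := by
    rw [← hq_sa.map_spectrum_real ρ hρ]
    exact (algebraMap_le_iff_le_spectrum (p := IsSelfAdjoint) (ha := hq)).1
      (algebraMap_le_of_mul_norm_sq_le hq hqκ)
  have hq0 : 0 ≤ q := by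
    rw [StarOrderedRing.nonneg_iff_spectrum_nonneg (R := ℝ) q hq_sa]
    exact fun t ht => hκ.le.trans (hspec t ht)
  have hqu : IsUnit q := by
    rw [← spectrum.zero_notMem_iff ℝ]
    exact fun h0 => absurd (hspec 0 h0) (not_le.2 hκ)
  refine isSimilarToStarRep_of_intertwining hq0 hqu fun a => hρ ?_
  rw [map_star, map_mul, map_mul, h]

end Similarity

instance {H : Type v} [NormedAddCommGroup H] [InnerProductSpace ℂ H] :
    InnerProductSpace ℂ (ULift.{u} H) where
  inner x y := inner ℂ x.down y.down
  norm_sq_eq_re_inner x := norm_sq_eq_re_inner x.down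
  conj_inner_symm x y := inner_conj_symm x.down y.down
  add_left x y z := inner_add_left x.down y.down z.down
  smul_left x y r := inner_smul_left x.down y.down r

/-- The ⋆-representation `a ⊗ b ↦ σ(a) τ(b)` of `A ⊗_max B` given by two ⋆-representations with
commuting ranges. The commuting pairs in the definition of `A ⊗_max B` act on spaces in the universe
of `A` and `B`, whence the passage to `ULift H`. -/
def MaxTensor.lift {A : Type u} {B : Type v} [NonUnitalCStarAlgebra A] [NonUnitalCStarAlgebra B]
    {H : Type v} [NormedAddCommGroup H] [InnerProductSpace ℂ H] [CompleteSpace H]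
    (σ : A →⋆ₙₐ[ℂ] (H →L[ℂ] H)) (τ : B →⋆ₙₐ[ℂ] (H →L[ℂ] H)) (h : ∀ a b, Commute (σ a) (τ b)) :
    MaxTensor A B →⋆ₙₐ[ℂ] (H →L[ℂ] H) :=
  let e : (ULift.{u} H →L[ℂ] ULift.{u} H) ≃⋆ₐ[ℂ] (H →L[ℂ] H) :=
    (LinearIsometryEquiv.ulift ℂ H).conjStarAlgEquiv
  e.toNonUnitalStarAlgHom.comp <| MaxTensor.eval
    { space := ULift.{u} H
      left := e.symm.toNonUnitalStarAlgHom.comp σ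
      right := e.symm.toNonUnitalStarAlgHom.comp τ
      commute := fun a b => (h a b).map e.symm }

lemma MaxTensor.lift_maxTmul {A : Type u} {B : Type v} [NonUnitalCStarAlgebra A]
    [NonUnitalCStarAlgebra B] {H : Type v} [NormedAddCommGroup H] [InnerProductSpace ℂ H]
    [CompleteSpace H] (σ : A →⋆ₙₐ[ℂ] (H →L[ℂ] H)) (τ : B →⋆ₙₐ[ℂ] (H →L[ℂ] H))
    (h : ∀ a b, Commute (σ a) (τ b)) (a : A) (b : B) :
    MaxTensor.lift σ τ h (maxTmul a b) = σ a * τ b := rfl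

section CommutantAction

variable {A : Type u} [CStarAlgebra A]
  {K : Type*} [NormedAddCommGroup K] [InnerProductSpace ℂ K] [CompleteSpace K]
  {H : Type v} [NormedAddCommGroup H] [InnerProductSpace ℂ H] [CompleteSpace H]
  {ρ : (K →L[ℂ] K) →⋆ₐ[ℂ] (H →L[ℂ] H)}

theorem IsSimilarToStarRep.exists_isBoundedRep_maxTensor {A : Type u} [NonUnitalCStarAlgebra A]
    {B : Type v} [NonUnitalCStarAlgebra B] {τ : B →⋆ₙₐ[ℂ] (H →L[ℂ] H)}
    (hρτ : ∀ x b, Commute (ρ x) (τ b)) {φ : A →ₙₐ[ℂ] (K →L[ℂ] K)}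
    (hφ : IsSimilarToStarRep φ) :
    ∃ Φ : MaxTensor A B →ₙₐ[ℂ] (H →L[ℂ] H), IsBoundedRep Φ ∧
      ∀ a b, Φ (maxTmul a b) = ρ (φ a) * τ b := by
  obtain ⟨S, π, hπ⟩ := hφ
  let Ψ := MaxTensor.lift (ρ.toNonUnitalStarAlgHom.comp π) τ fun a b => hρτ (π a) b
  have hΨ_maxTmul (a b) : Ψ (maxTmul a b) = ρ (π a) * τ b := MaxTensor.lift_maxTmul ..
  let s : (H →L[ℂ] H)ˣ := Units.map (ρ : (K →L[ℂ] K) →* (H →L[ℂ] H)) S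
  have hΨ : IsBoundedRep (Ψ : MaxTensor A B →ₙₐ[ℂ] (H →L[ℂ] H)) :=
    ⟨1, fun x => (NonUnitalStarAlgHom.norm_apply_le Ψ x).trans_eq (one_mul _).symm⟩
  refine ⟨conjRep (Ψ : MaxTensor A B →ₙₐ[ℂ] (H →L[ℂ] H)) s, hΨ.conjRep s, fun a b => ?_⟩
  calc ↑s⁻¹ * Ψ (maxTmul a b) * ρ S = ↑s⁻¹ * (ρ (π a) * τ b) * ρ S := by
        rw [hΨ_maxTmul]
    _ = ↑s⁻¹ * ρ (π a) * ρ S * τ b := by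
        rw [mul_assoc, mul_assoc (ρ _), ← (hρτ S b).eq]
        simp only [mul_assoc]
    _ = ρ (↑S⁻¹ * π a * S) * τ b := by simp only [map_mul]; rfl
    _ = ρ (φ a) * τ b := by rw [hπ]; simp [mul_assoc]

theorem isSimilarToStarRep_of_isBoundedRep_maxTensor (hK : ¬ FiniteDimensional ℂ K)
    {M : VonNeumannAlgebra H} (hρ : Function.Injective ρ)
    (hM : (M : Set (H →L[ℂ] H)) = Set.range ρ) {ξ : H}
    (hξ : IsSeparatingVector (M : Set (H →L[ℂ] H)) ξ)
    {B : NonUnitalStarSubalgebra ℂ (H →L[ℂ] H)} [IsClosed (B : Set (H →L[ℂ] H))]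
    (hB : IsWeaklyDenseIn (B : Set (H →L[ℂ] H)) (M.commutant : Set (H →L[ℂ] H)))
    {φ : A →ₙₐ[ℂ] (K →L[ℂ] K)} {Φ : MaxTensor A B →ₙₐ[ℂ] (H →L[ℂ] H)} (hΦ : IsBoundedRep Φ)
    (hΦφ : ∀ a (b : B), Φ (maxTmul a b) = ρ (φ a) * (b : H →L[ℂ] H)) :
    IsSimilarToStarRep φ := by
  have hρM (x) : ρ x ∈ M := by rw [← SetLike.mem_coe, hM]; exact ⟨x, rfl⟩
  have hcomm (x) (b : B) : Commute (ρ x) (b : H →L[ℂ] H) :=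
    VonNeumannAlgebra.mem_commutant_iff.1 (hB.1 b.2) _ (hρM x)
  obtain ⟨v, hvM, hv⟩ := exists_orthogonal_isometries_mem_commutant hK hM fun x hx =>
    hρ ((hξ _ (hρM x) hx).trans (map_zero ρ).symm)
  obtain ⟨q, hq, hqB, hqφ, κ, hκ, hlower⟩ := exists_isSelfAdjoint_star_map_mul_of_maxTensor
    (ψ := (ρ : (K →L[ℂ] K) →ₙₐ[ℂ] (H →L[ℂ] H)).comp φ) (τ := NonUnitalStarSubalgebraClass.subtype B)
    (fun a b => hcomm (φ a) b) hΦ hΦφ (hasNormingRows_subtype hB hvM hv) (hB.denseRange_apply hξ)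
  have hqM : q ∈ M := hB.mem_of_forall_commute fun b hb => hqB ⟨b, hb⟩
  rw [← SetLike.mem_coe, hM] at hqM
  obtain ⟨q, rfl⟩ := hqM
  exact isSimilarToStarRep_of_faithful ρ hρ hq hκ hlower hqφ

end CommutantAction

theorem mainTheorem8_general {A : Type u} [CStarAlgebra A]
    {K : Type*} [NormedAddCommGroup K] [InnerProductSpace ℂ K] [CompleteSpace K]
    (hK : ¬ FiniteDimensional ℂ K)
    {H : Type v} [NormedAddCommGroup H] [InnerProductSpace ℂ H] [CompleteSpace H]
    (M : VonNeumannAlgebra H) (ρ : (K →L[ℂ] K) ≃⋆ₐ[ℂ] M.toStarSubalgebra)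
    (ξ : H) (hsep : IsSeparatingVector (M : Set (H →L[ℂ] H)) ξ)
    (B : NonUnitalStarSubalgebra ℂ (H →L[ℂ] H)) [IsClosed (B : Set (H →L[ℂ] H))]
    (hB : IsWeaklyDenseIn (B : Set (H →L[ℂ] H)) (M.commutant : Set (H →L[ℂ] H)))
    (φ : A →ₙₐ[ℂ] (K →L[ℂ] K)) :
    IsSimilarToStarRep φ ↔ ∃ Φ : MaxTensor A B →ₙₐ[ℂ] (H →L[ℂ] H), IsBoundedRep Φ ∧
      ∀ (a : A) (b : B), Φ (maxTmul a b) = (ρ (φ a) : H →L[ℂ] H) * (b : H →L[ℂ] H) := by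
  let ρ' : (K →L[ℂ] K) →⋆ₐ[ℂ] (H →L[ℂ] H) :=
    M.toStarSubalgebra.subtype.comp (ρ : (K →L[ℂ] K) →⋆ₐ[ℂ] M.toStarSubalgebra)
  have hρ' : Function.Injective ρ' := Subtype.val_injective.comp (EquivLike.injective ρ)
  have hM : (M : Set (H →L[ℂ] H)) = Set.range ρ' :=
    (Subtype.range_coe.symm).trans ((EquivLike.surjective ρ).range_comp Subtype.val).symm
  constructor
  · exact fun hφ => hφ.exists_isBoundedRep_maxTensor (ρ := ρ')
      (τ := NonUnitalStarSubalgebraClass.subtype B)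
      fun x b => VonNeumannAlgebra.mem_commutant_iff.1 (hB.1 b.2) _ (ρ x).2
  · rintro ⟨Φ, hΦ, hΦφ⟩
    exact isSimilarToStarRep_of_isBoundedRep_maxTensor hK hρ' hM hsep hB hΦ hΦφ

lemma not_finiteDimensional_ellTwo : ¬ FiniteDimensional ℂ EllTwo := fun _ =>
  let b : HilbertBasis ℕ ℂ EllTwo := .ofRepr (.refl ℂ EllTwo)
  have := b.orthonormal.linearIndependent.finite
  not_finite ℕ

end

theorem mainTheorem8 {H : Type*} [NormedAddCommGroup H] [InnerProductSpace ℂ H] [CompleteSpace H]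
    (M : VonNeumannAlgebra H) (ρ : (EllTwo →L[ℂ] EllTwo) ≃⋆ₐ[ℂ] M.toStarSubalgebra)
    (ξ : H) (hcyc : IsCyclicVector (M : Set (H →L[ℂ] H)) ξ)
    (hsep : IsSeparatingVector (M : Set (H →L[ℂ] H)) ξ)
    (B : NonUnitalStarSubalgebra ℂ (H →L[ℂ] H)) [IsClosed (B : Set (H →L[ℂ] H))]
    (hB : IsWeaklyDenseIn (B : Set (H →L[ℂ] H)) (M.commutant : Set (H →L[ℂ] H)))
    (φ : CStarFInfty →ₙₐ[ℂ] (EllTwo →L[ℂ] EllTwo)) (hφ : IsBoundedRep φ) :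
    IsSimilarToStarRep φ ↔
      ∃ Φ : MaxTensor CStarFInfty B →ₙₐ[ℂ] (H →L[ℂ] H), IsBoundedRep Φ ∧
        ∀ (a : CStarFInfty) (b : B),
          Φ (maxTmul a b) = (ρ (φ a) : H →L[ℂ] H) * (b : H →L[ℂ] H) :=
  mainTheorem8_general not_finiteDimensional_ellTwo M ρ ξ hsep B hB φ
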